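/- Let $L>0$ and $H=L^2(0,L)$ (real), with scalar product $\langle\cdot,\cdot\rangle$ and norm $|\cdot|$. Let $\mathcal B=a\,\partial_\xi^2+b\,\partial_\xi+c$ be a uniformly elliptic operator with $a,b,c$ continuous on $[0,L]$, and let $\mathcal N$ be either the identity (Dirichlet condition) or $\beta\,\partial_\xi+\gamma$ with $\beta,\gamma\in C^1[0,L]$, $\beta(0)\ne0\ne\beta(L)$. Let $B$ be the realization of $\mathcal B$ in $H$ with domain $\{x\in W^{2,2}(0,L):\mathcal N x(0)=\mathcal N x(L)=0\}$. Assume that $H$ has a complete orthonormal basis $\{e_k\}_{k\in\mathbb N}$ with $Be_k=-\alpha_ke_k$ and $\lambda:=\inf_k\alpha_k>0$. Let $f,g:[0,L]\times\mathbb R^2\to\mathbb R$ be measurable with $f(\cdot,0,0),\,g(\cdot,0,0)\in L^2(0,L)$, and assume: - for almost every $\xi$, $f(\xi,\cdot)\in C^1(\mathbb R^2)$, with first derivatives bounded uniformly in $\xi$; - for every $\sigma_2\in\mathbb R$ and almost every $\xi$, $g(\xi,\cdot,\sigma_2)\in C^1(\mathbb R)$, and for every $\sigma_1\in\mathbb R$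 and almost every $\xi$, $g(\xi,\sigma_1,\cdot)\in C^3(\mathbb R)$, with all these derivatives (of order at least one) uniformly bounded, by a constant that does not depend on $\xi,\sigma_1,\sigma_2$; - there is $L_g<\lambda$ such that, for almost every $\xi$, $\partial g/\partial\sigma_2(\xi,\sigma)$ exists and $|\partial g/\partial\sigma_2(\xi,\sigma)|\le L_g$ for all $\sigma\in\mathbb R^2$. For $x,y\in H$ set $F(x,y)(\xi)=f(\xi,x(\xi),y(\xi))$, $G(x,y)(\xi)=g(\xi,x(\xi),y(\xi))$ and $U(x,y)=\int_0^1\langle G(x,\theta y),y\rangle\,d\theta$. Let $N(0,(-B)^{-1}/2)$ be the centred Gaussian measure on $H$ with covariance operator $(-B)^{-1}/2$, that is, the law of $\sum_k(2\alpha_k)^{-1/2}\zeta_ke_k$ with $\zeta_k$ independent standard normal variables, and set $$\mu^x(dy)=\frac1{Z(x)}\,e^{2U(x,y)}\,N(0,(-B)^{-1}/2)(dy),\qquad Z(x)=\int_He^{2U(x,y)}\,N(0,(-B)^{-1}/2)(dy),$$ $$\bar F(x)=\int_HF(x,y)\,\mu^x(dy),\qquad x\in H.$$ Then, for all $x\in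 H$, $\mu^x$ is a well-defined probability measure and $F(x,\cdot)$ is $\mu^x$-integrable in $H$; for all $x,y\in H$, the map $F(\cdot,y):H\to H$ is Gâteaux differentiable at $x$ with derivative $D_xF(x,y)k=\frac{\partial f}{\partial\sigma_1}(\cdot,x,y)\,k$, $k\in H$, and $U(\cdot,y):H\to\mathbb R$ is Fréchet differentiable at $x$, with derivative denoted by $U_x(x,y)\in H$. Moreover, for every $h\in L^\infty(0,L)$, the map $x\mapsto\langle\bar F(x),h\rangle$ is Fréchet differentiable on $H$, and for all $x,k\in H$ its derivative at $x$ in the direction $k$ is $$\int_H\langle D_xF(x,y)k,h\rangle\,\mu^x(dy)+2\int_H\langle U_x(x,y),k\rangle\langle F(x,y),h\rangle\,\mu^x(dy)-2\int_H\langle U_x(x,y),k\rangle\,\mu^x(dy)\int_H\langle F(x,y),h\rangle\,\mu^x(dy),$$ where all integrands are $\mu^x$-integrable. -/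

import Mathlib

open MeasureTheory ProbabilityTheory

namespace FastSlow

/-- Lebesgue measure on the interval `(0, L)`. -/
noncomputable abbrev vol (L : ℝ) : Measure ℝ := volume.restrict (Set.Ioo 0 L)

/-- The Hilbert space `H = L²(0, L)`. -/
abbrev H (L : ℝ) : Type := Lp ℝ 2 (vol L)

/-- `H` carries its Borel σ-algebra. -/
noncomputable instance instMeasurableSpaceH (L : ℝ) : MeasurableSpace (H L) := borel (H L)

instance instBorelSpaceH (L : ℝ) : BorelSpace (H L) := ⟨rfl⟩

/-! ### The second order elliptic operator and its realization in `H` -/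

/-- A boundary operator: the identity (Dirichlet) or the first order operator
`β(ξ) ∂/∂ξ + γ(ξ)`, `ξ ∈ {0, L}`. -/
inductive BoundaryOp where
  | dirichlet : BoundaryOp
  | firstOrder (β γ : ℝ → ℝ) : BoundaryOp

/-- In the first order case `β, γ ∈ C¹[0, L]` and `β ≠ 0` at both end points. -/
def BoundaryOp.Admissible (L : ℝ) : BoundaryOp → Prop
  | .dirichlet => True
  | .firstOrder β γ =>
      ContDiffOn ℝ 1 β (Set.Icc 0 L) ∧ ContDiffOn ℝ 1 γ (Set.Icc 0 L) ∧ β 0 ≠ 0 ∧ β L ≠ 0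

/-- The value at `ξ` of the boundary operator on a function `u` with derivative `u'`. -/
def BoundaryOp.eval (u u' : ℝ → ℝ) (ξ : ℝ) : BoundaryOp → ℝ
  | .dirichlet => u ξ
  | .firstOrder β γ => β ξ * u' ξ + γ ξ * u ξ

/-- A second order uniformly elliptic operator `a ∂² + b ∂ + c` with continuous coefficients on
`[0, L]`, together with a boundary operator. -/
structure EllipticOp (L : ℝ) where
  a : ℝ → ℝ
  b : ℝ → ℝ
  c : ℝ → ℝ
  bdry : BoundaryOp
  continuousOn_a : ContinuousOn a (Set.Icc 0 L)
  continuousOn_b : ContinuousOn b (Set.Icc 0 L)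
  continuousOn_c : ContinuousOn c (Set.Icc 0 L)
  elliptic : ∃ ν : ℝ, 0 < ν ∧ ∀ ξ ∈ Set.Icc 0 L, ν ≤ a ξ
  admissible : bdry.Admissible L

/-- `x` belongs to `W^{2,2}(0, L)`, with `C¹` representative `u` on `[0, L]`, first derivative `u'`
and weak second derivative `w ∈ L²(0, L)`: both `u` and `u'` are absolutely continuous on `[0, L]`,
with (a.e.) derivatives `u'` and `w`. -/
structure IsW22 {L : ℝ} (x : H L) (u u' : ℝ → ℝ) (w : H L) : Prop where
  ae_eq : x =ᵐ[vol L] u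
  eq_integral : ∀ ξ ∈ Set.Icc 0 L, u ξ = u 0 + ∫ s in (0 : ℝ)..ξ, u' s
  deriv_eq_integral : ∀ ξ ∈ Set.Icc 0 L, u' ξ = u' 0 + ∫ s in (0 : ℝ)..ξ, w s

/-- The graph of the realization `B` in `H` of the elliptic operator with its boundary conditions:
`(x, z)` belongs to it iff `x ∈ W^{2,2}(0, L)` satisfies the boundary conditions at `0` and `L`,
and `z = B x`. -/
def EllipticOp.graph {L : ℝ} (B : EllipticOp L) : Set (H L × H L) :=
  {p | ∃ (u u' : ℝ → ℝ) (w : H L), IsW22 p.1 u u' w ∧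
    B.bdry.eval u u' 0 = 0 ∧ B.bdry.eval u u' L = 0 ∧
    p.2 =ᵐ[vol L] fun ξ => B.a ξ * w ξ + B.b ξ * u' ξ + B.c ξ * u ξ}

/-- The complete orthonormal basis `e` of `H` consists of eigenvectors, `B eₖ = -αₖ eₖ`, and
`λ = inf αₖ > 0`. (In `ℝ`, the infimum of a sequence that is unbounded below is `0` by convention,
so that the second condition also says that `α` is bounded below.) -/
structure Diagonalizes {L : ℝ} (B : EllipticOp L) (e : HilbertBasis ℕ ℝ (H L)) (α : ℕ → ℝ) :
    Prop where
  eigen : ∀ k, (e k, -(α k) • e k) ∈ B.graph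
  pos : 0 < ⨅ k, α k

/-! ### The reaction coefficients

They are functions on `[0, L] × ℝ²`, written as functions on `ℝ × ℝ²` whose values outside
`[0, L] × ℝ²` play no role. -/

/-- Assumptions on the slow reaction coefficient `f`. -/
structure SlowReaction (L : ℝ) (f : ℝ → ℝ → ℝ → ℝ) : Prop where
  measurable : Measurable fun p : ℝ × ℝ × ℝ => f p.1 p.2.1 p.2.2
  memLp_zero : MemLp (fun ξ => f ξ 0 0) 2 (vol L)
  contDiff : ∀ᵐ ξ ∂(vol L), ContDiff ℝ 1 fun σ : ℝ × ℝ => f ξ σ.1 σ.2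
  bounded : ∃ M : ℝ, ∀ᵐ ξ ∂(vol L), ∀ σ : ℝ × ℝ,
    ‖fderiv ℝ (fun σ : ℝ × ℝ => f ξ σ.1 σ.2) σ‖ ≤ M

/-- Assumptions on the fast reaction coefficient `g`; `lam` is the constant `λ = inf αₖ`. -/
structure FastReaction (L lam : ℝ) (g : ℝ → ℝ → ℝ → ℝ) : Prop where
  measurable : Measurable fun p : ℝ × ℝ × ℝ => g p.1 p.2.1 p.2.2
  memLp_zero : MemLp (fun ξ => g ξ 0 0) 2 (vol L)
  contDiff_fst : ∀ σ₂ : ℝ, ∀ᵐ ξ ∂(vol L), ContDiff ℝ 1 fun σ₁ => g ξ σ₁ σ₂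
  bounded_fst : ∃ M : ℝ, ∀ σ₂ : ℝ, ∀ᵐ ξ ∂(vol L), ∀ σ₁ : ℝ,
    |deriv (fun s => g ξ s σ₂) σ₁| ≤ M
  contDiff_snd : ∀ σ₁ : ℝ, ∀ᵐ ξ ∂(vol L), ContDiff ℝ 3 fun σ₂ => g ξ σ₁ σ₂
  bounded_snd : ∃ M : ℝ, ∀ σ₁ : ℝ, ∀ᵐ ξ ∂(vol L), ∀ σ₂ : ℝ, ∀ j ∈ Finset.Icc 1 3,
    |iteratedDeriv j (fun s => g ξ σ₁ s) σ₂| ≤ M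
  dissipative : ∃ Lg : ℝ, Lg < lam ∧ ∀ᵐ ξ ∂(vol L), ∀ σ₁ σ₂ : ℝ,
    DifferentiableAt ℝ (fun s => g ξ σ₁ s) σ₂ ∧ |deriv (fun s => g ξ σ₁ s) σ₂| ≤ Lg

/-! ### Nemytskii operators -/

open Classical in
/-- The class in `H` of a square integrable function on `(0, L)` (and `0` otherwise). -/
noncomputable def toH (L : ℝ) (φ : ℝ → ℝ) : H L :=
  if hφ : MemLp φ 2 (vol L) then hφ.toLp φ else 0

/-- The Nemytskii operator `(x, y) ↦ f(·, x(·), y(·))` on `H × H`. -/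
noncomputable def nemytskii {L : ℝ} (f : ℝ → ℝ → ℝ → ℝ) (x y : H L) : H L :=
  toH L fun ξ => f ξ (x ξ) (y ξ)

/-- The Gâteaux derivative `D_x F(x, y) k = ∂f/∂σ₁(·, x, y) k` of the Nemytskii operator `F` of `f`
in its first argument. -/
noncomputable def nemytskiiDx {L : ℝ} (f : ℝ → ℝ → ℝ → ℝ) (x y k : H L) : H L :=
  toH L fun ξ => deriv (fun s => f ξ s (y ξ)) (x ξ) * k ξ

/-- A measurable function of linear growth in `σ`, with square integrable value at `σ = 0`, sends
pairs of square integrable functions to square integrable functions. -/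
theorem memLp_comp_of_growth {L : ℝ} {f : ℝ → ℝ → ℝ → ℝ}
    (hm : Measurable fun p : ℝ × ℝ × ℝ => f p.1 p.2.1 p.2.2)
    (h0 : MemLp (fun ξ => f ξ 0 0) 2 (vol L)) (M N : ℝ)
    (hb : ∀ᵐ ξ ∂(vol L), ∀ s t : ℝ, |f ξ s t| ≤ |f ξ 0 0| + M * |s| + N * |t|) (x y : H L) :
    MemLp (fun ξ => f ξ (x ξ) (y ξ)) 2 (vol L) := by
  have hx : MemLp x 2 (vol L) := Lp.memLp x
  have hy : MemLp y 2 (vol L) := Lp.memLp y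
  have hb' : MemLp (fun ξ => |f ξ 0 0| + M * |x ξ| + N * |y ξ|) 2 (vol L) :=
    (h0.abs.add (hx.abs.const_mul M)).add (hy.abs.const_mul N)
  refine hb'.mono' ?_ ?_
  · exact (hm.comp_aemeasurable (aemeasurable_id.prodMk
      (hx.aestronglyMeasurable.aemeasurable.prodMk
        hy.aestronglyMeasurable.aemeasurable))).aestronglyMeasurable
  · filter_upwards [hb] with ξ hξ
    exact hξ _ _

/-- Under the assumptions on `f`, its Nemytskii operator maps `H × H` into `H`. -/
theorem SlowReaction.memLp {L : ℝ} {f : ℝ → ℝ → ℝ → ℝ} (hf : SlowReaction L f) (x y : H L) :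
    MemLp (fun ξ => f ξ (x ξ) (y ξ)) 2 (vol L) := by
  obtain ⟨M, hM⟩ := hf.bounded
  refine memLp_comp_of_growth hf.measurable hf.memLp_zero M M ?_ x y
  filter_upwards [hf.contDiff, hM] with ξ h1 h2 s t
  have h := Convex.norm_image_sub_le_of_norm_fderiv_le (𝕜 := ℝ) (s := Set.univ)
    (f := fun σ : ℝ × ℝ => f ξ σ.1 σ.2) (x := (0, 0)) (y := (s, t)) (C := M)
    (fun σ _ => (h1.differentiable (by norm_num)) σ) (fun σ _ => h2 σ) convex_univ
    (Set.mem_univ _) (Set.mem_univ _)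
  have hM0 : 0 ≤ M := (norm_nonneg _).trans (h2 0)
  have hst : ‖((s, t) : ℝ × ℝ) - (0, 0)‖ ≤ |s| + |t| := by
    simp only [Prod.norm_def, Prod.mk_sub_mk, sub_zero, Real.norm_eq_abs]
    exact max_le (by linarith [abs_nonneg t]) (by linarith [abs_nonneg s])
  have h3 := mul_le_mul_of_nonneg_left hst hM0
  have h4 : |f ξ s t - f ξ 0 0| ≤ M * (|s| + |t|) := le_trans (by simpa using h) h3
  linarith [abs_sub_abs_le_abs_sub (f ξ s t) (f ξ 0 0)]

/-- Under the assumptions on `g`, its Nemytskii operator maps `H × H` into `H`. -/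
theorem FastReaction.memLp {L lam : ℝ} {g : ℝ → ℝ → ℝ → ℝ} (hg : FastReaction L lam g)
    (x y : H L) : MemLp (fun ξ => g ξ (x ξ) (y ξ)) 2 (vol L) := by
  obtain ⟨M, hM⟩ := hg.bounded_fst
  obtain ⟨N, -, hN⟩ := hg.dissipative
  refine memLp_comp_of_growth hg.measurable hg.memLp_zero M N ?_ x y
  filter_upwards [hg.contDiff_fst 0, hM 0, hN] with ξ h1 h2 h3 s t
  have h4 := Convex.norm_image_sub_le_of_norm_deriv_le (𝕜 := ℝ) (s := Set.univ)
    (f := fun r => g ξ r 0) (x := 0) (y := s) (C := M)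
    (fun r _ => (h1.differentiable (by norm_num)) r) (fun r _ => h2 r) convex_univ
    (Set.mem_univ _) (Set.mem_univ _)
  have h5 := Convex.norm_image_sub_le_of_norm_deriv_le (𝕜 := ℝ) (s := Set.univ)
    (f := fun r => g ξ s r) (x := 0) (y := t) (C := N)
    (fun r _ => (h3 s r).1) (fun r _ => (h3 s r).2) convex_univ
    (Set.mem_univ _) (Set.mem_univ _)
  simp only [sub_zero, Real.norm_eq_abs] at h4 h5
  linarith [abs_sub_abs_le_abs_sub (g ξ s 0) (g ξ 0 0), abs_sub_abs_le_abs_sub (g ξ s t) (g ξ s 0)]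

/-! ### The Gaussian measure, the invariant measure and the averaged coefficient -/

/-- The centred Gaussian measure `N(0, (-B)⁻¹/2)` on `H`, where `B eₖ = -αₖ eₖ`, in its
Karhunen-Loève form: the law of `∑ₖ (2 αₖ)^{-1/2} ζₖ eₖ` with independent standard normal `ζₖ`.
(The series converges almost surely as `∑ₖ 1/αₖ < ∞`, `B` being elliptic of second order on a
bounded interval.) -/
noncomputable def gaussian {L : ℝ} (e : HilbertBasis ℕ ℝ (H L)) (α : ℕ → ℝ) : Measure (H L) :=
  (Measure.infinitePi fun _ : ℕ => gaussianReal 0 1).map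
    fun ζ : ℕ → ℝ => ∑' k, (ζ k / Real.sqrt (2 * α k)) • e k

/-- `U(x, y) = ∫₀¹ ⟨G(x, θ y), y⟩ dθ`, with `G` the Nemytskii operator of `g`. -/
noncomputable def potential {L : ℝ} (g : ℝ → ℝ → ℝ → ℝ) (x y : H L) : ℝ :=
  ∫ θ in (0 : ℝ)..1, inner ℝ (nemytskii g x (θ • y)) y

/-- The measure `μˣ(dy) = Z(x)⁻¹ exp(2 U(x, y)) N(0, (-B)⁻¹/2)(dy)`, where
`Z(x) = ∫ exp(2 U(x, y)) N(0, (-B)⁻¹/2)(dy)`. -/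
noncomputable def invMeasure {L : ℝ} (e : HilbertBasis ℕ ℝ (H L)) (α : ℕ → ℝ)
    (g : ℝ → ℝ → ℝ → ℝ) (x : H L) : Measure (H L) :=
  (gaussian e α).tilted fun y => 2 * potential g x y

/-- The averaged coefficient `F̄(x) = ∫ F(x, y) μˣ(dy)`, an integral in `H`. -/
noncomputable def averaged {L : ℝ} (e : HilbertBasis ℕ ℝ (H L)) (α : ℕ → ℝ)
    (f g : ℝ → ℝ → ℝ → ℝ) (x : H L) : H L :=
  ∫ y, nemytskii f x y ∂(invMeasure e α g x)

end FastSlow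

open FastSlow

namespace FastSlow

/-! ### Growth of the eigenvalues -/

/-! Everything is a quotient of Gaussian integrals, `⟨F̄(x), h⟩ = ∫ e^{2U} ⟨F, h⟩ dγ / ∫ e^{2U} dγ`,
and the asserted formula is the quotient rule. The work lies in making the integrals converge and in
differentiating their integrands.

Convergence. The Gaussian measure lives on `H` because `∑ 1/αₖ < ∞`, which comes from a dimension
count. If more than `2n` eigenvalues were at most of order `n²`, some nonzero combination `x` of
their eigenfunctions would vanish together with `x'` at `n` equidistant nodes. Two Poincaré
inequalities then bound `x` by `(L/n)² x''`, while ellipticity bounds `x''` by `Bx` and lower order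
terms, hence by a small multiple of itself (`EllipticOp.eq_zero_of_vanishing`,
`Diagonalizes.card_le`). By independence `exp(c|y|²)` is integrable for every `c < λ`
(`integrable_exp_norm_sq_gaussian`). Since `2U(x, y)` is at most `N|y|²` plus a term linear in
`|y|`, with `N = L_g < λ`, a choice `N < c < λ` leaves room for every factor of exponential growth
in `|y|`, locally uniformly in `x`.

Differentiability. A Nemytskii operator on `L²` is in general only Gâteaux differentiable, but
pairing it with a fixed `L²` function gives an integral functional whose integrand has a square
integrable Lipschitz constant, and Cauchy–Schwarz makes it Fréchet differentiable
(`differentiableAt_integral_comp`). This applies to `⟨F(·, y), h⟩` and to `U(·, y)`, an integral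
over `(θ, ξ)`. For `g`, the null set where differentiability in `σ₁` fails depends on `σ₂`; Fubini's
theorem handles this (`FastReaction.ae_ae_differentiableAt`). Dominated differentiation then yields
the derivatives of numerator and denominator. -/

theorem sq_intervalIntegral_le {w : ℝ → ℝ} {p q : ℝ} (hpq : p ≤ q)
    (hw : IntervalIntegrable w volume p q)
    (hw2 : IntervalIntegrable (fun s => w s ^ 2) volume p q) :
    (∫ s in p..q, w s) ^ 2 ≤ (q - p) * ∫ s in p..q, w s ^ 2 := by
  rcases hpq.eq_or_lt with rfl | hlt
  · simp
  have hpos : 0 < q - p := sub_pos.2 hlt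
  -- With `t` the mean of `w`, Cauchy–Schwarz is the nonnegativity of the integral of `(w - t)²`.
  set t : ℝ := (∫ s in p..q, w s) / (q - p) with ht
  have h0 : 0 ≤ ∫ s in p..q, (w s - t) ^ 2 :=
    intervalIntegral.integral_nonneg hpq fun s _ => sq_nonneg _
  have h1 : ∫ s in p..q, (w s - t) ^ 2 =
      (∫ s in p..q, w s ^ 2) - 2 * t * (∫ s in p..q, w s) + (q - p) * t ^ 2 := by
    have : (fun s => (w s - t) ^ 2) = fun s => w s ^ 2 - 2 * t * w s + t ^ 2 := by
      ext s; ring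
    rw [this, intervalIntegral.integral_add (hw2.sub (hw.const_mul _)) intervalIntegrable_const,
      intervalIntegral.integral_sub hw2 (hw.const_mul _), intervalIntegral.integral_const_mul,
      intervalIntegral.integral_const, smul_eq_mul]
  have h2 : (∫ s in p..q, w s) = t * (q - p) := by rw [ht]; field_simp
  rw [h1, h2] at h0
  rw [h2]
  nlinarith

/-- Cauchy–Schwarz bounds `v²` pointwise by `(q - p) ∫ w²`, and integrating costs another factor `q
- p`. This crude Poincaré constant suffices, as only its scaling in the length matters. -/
theorem intervalIntegral_sq_primitive_le {v w : ℝ → ℝ} {p q : ℝ} (hpq : p ≤ q)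
    (hw : IntervalIntegrable w volume p q)
    (hw2 : IntervalIntegrable (fun s => w s ^ 2) volume p q)
    (hv : ∀ ξ ∈ Set.Icc p q, v ξ = ∫ s in p..ξ, w s) :
    ∫ ξ in p..q, v ξ ^ 2 ≤ (q - p) ^ 2 * ∫ s in p..q, w s ^ 2 := by
  have hnn : 0 ≤ ∫ s in p..q, w s ^ 2 :=
    intervalIntegral.integral_nonneg hpq fun s _ => sq_nonneg _
  have key : ∀ ξ ∈ Set.Icc p q, v ξ ^ 2 ≤ (q - p) * ∫ s in p..q, w s ^ 2 := by
    intro ξ hξ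
    have hsub : Set.uIcc p ξ ⊆ Set.uIcc p q := by
      rw [Set.uIcc_of_le hξ.1, Set.uIcc_of_le hpq]; exact Set.Icc_subset_Icc_right hξ.2
    have hsub' : Set.uIcc ξ q ⊆ Set.uIcc p q := by
      rw [Set.uIcc_of_le hξ.2, Set.uIcc_of_le hpq]; exact Set.Icc_subset_Icc_left hξ.1
    have h1 := sq_intervalIntegral_le hξ.1 (hw.mono_set hsub) (hw2.mono_set hsub)
    have h2 := intervalIntegral.integral_add_adjacent_intervals (hw2.mono_set hsub)
      (hw2.mono_set hsub')
    have h3 : 0 ≤ ∫ s in ξ..q, w s ^ 2 :=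
      intervalIntegral.integral_nonneg hξ.2 fun s _ => sq_nonneg _
    have h4 : 0 ≤ ∫ s in p..ξ, w s ^ 2 :=
      intervalIntegral.integral_nonneg hξ.1 fun s _ => sq_nonneg _
    rw [hv ξ hξ]
    refine h1.trans (mul_le_mul (by linarith [hξ.2]) (by linarith) h4 (by linarith))
  have hcont : ContinuousOn v (Set.uIcc p q) := by
    have := intervalIntegral.continuousOn_primitive_interval' hw Set.left_mem_uIcc
    refine this.congr fun ξ hξ => ?_
    rw [Set.uIcc_of_le hpq] at hξ
    exact hv ξ hξ
  calc ∫ ξ in p..q, v ξ ^ 2 ≤ ∫ ξ in p..q, (q - p) * ∫ s in p..q, w s ^ 2 :=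
        intervalIntegral.integral_mono_on hpq (hcont.pow 2).intervalIntegrable
          intervalIntegrable_const key
    _ = _ := by rw [intervalIntegral.integral_const, smul_eq_mul]; ring

theorem continuousOn_of_eq_primitive {L : ℝ} (hL : 0 < L) {v w : ℝ → ℝ}
    (hw : IntervalIntegrable w volume 0 L)
    (hv : ∀ ξ ∈ Set.Icc 0 L, v ξ = v 0 + ∫ s in (0 : ℝ)..ξ, w s) :
    ContinuousOn v (Set.uIcc 0 L) := by
  have := intervalIntegral.continuousOn_primitive_interval' hw Set.left_mem_uIcc
  refine ((continuousOn_const (c := v 0)).add this).congr fun ξ hξ => ?_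
  rw [Set.uIcc_of_le hL.le] at hξ
  exact hv ξ hξ

/-- A Poincaré inequality for a function that vanishes at the left end points of the pieces of an
equipartition of `[0, L]`. -/
theorem intervalIntegral_sq_le_of_vanishing {L : ℝ} (hL : 0 < L) {v w : ℝ → ℝ}
    (hw : IntervalIntegrable w volume 0 L)
    (hw2 : IntervalIntegrable (fun s => w s ^ 2) volume 0 L)
    (hv : ∀ ξ ∈ Set.Icc 0 L, v ξ = v 0 + ∫ s in (0 : ℝ)..ξ, w s)
    {n : ℕ} (hn : 0 < n) (h0 : ∀ i < n, v (i * (L / n)) = 0) :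
    ∫ ξ in (0 : ℝ)..L, v ξ ^ 2 ≤ (L / n) ^ 2 * ∫ s in (0 : ℝ)..L, w s ^ 2 := by
  have hn' : (0 : ℝ) < n := Nat.cast_pos.2 hn
  have hl : 0 < L / n := div_pos hL hn'
  have hmem : ∀ i ≤ n, (i : ℝ) * (L / n) ∈ Set.Icc 0 L := by
    intro i hi
    refine ⟨by positivity, ?_⟩
    have : (i : ℝ) ≤ n := Nat.cast_le.2 hi
    calc (i : ℝ) * (L / n) ≤ n * (L / n) := mul_le_mul_of_nonneg_right this hl.le
      _ = L := by field_simp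
  have hsub : ∀ a ∈ Set.Icc 0 L, ∀ b ∈ Set.Icc 0 L, Set.uIcc a b ⊆ Set.uIcc 0 L := by
    intro a ha b hb
    rw [Set.uIcc_of_le hL.le]
    exact Set.uIcc_subset_Icc ha hb
  have hcont := continuousOn_of_eq_primitive hL hw hv
  have hv2 : IntervalIntegrable (fun s => v s ^ 2) volume 0 L := (hcont.pow 2).intervalIntegrable
  have hpiece : ∀ i ∈ Finset.range n,
      ∫ ξ in (i * (L / n) : ℝ)..((i + 1 : ℕ) * (L / n) : ℝ), v ξ ^ 2 ≤
        (L / n) ^ 2 * ∫ ξ in (i * (L / n) : ℝ)..((i + 1 : ℕ) * (L / n) : ℝ), w ξ ^ 2 := by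
    intro i hi
    have hi := Finset.mem_range.1 hi
    have hp := hmem i hi.le
    have hq := hmem (i + 1) hi
    have hle : (i : ℝ) * (L / n) ≤ (i + 1 : ℕ) * (L / n) := by push_cast; nlinarith
    have := intervalIntegral_sq_primitive_le hle (hw.mono_set (hsub _ hp _ hq))
      (hw2.mono_set (hsub _ hp _ hq)) (v := v) (fun ξ hξ => by
        have hξ' : ξ ∈ Set.Icc 0 L := ⟨hp.1.trans hξ.1, hξ.2.trans hq.2⟩
        have e1 := hv ξ hξ'
        have e2 := hv _ hp
        rw [h0 i hi] at e2
        have e3 := intervalIntegral.integral_add_adjacent_intervals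
          (hw.mono_set (hsub 0 ⟨le_rfl, hL.le⟩ _ hp)) (hw.mono_set (hsub _ hp _ hξ'))
        linarith)
    have e : ((i + 1 : ℕ) : ℝ) * (L / n) - i * (L / n) = L / n := by push_cast; ring
    rwa [e] at this
  have hend : (n : ℝ) * (L / n) = L := by field_simp
  have hsum : ∀ z : ℝ → ℝ, IntervalIntegrable z volume 0 L →
      ∑ i ∈ Finset.range n, ∫ ξ in (i * (L / n) : ℝ)..((i + 1 : ℕ) * (L / n) : ℝ), z ξ =
        ∫ ξ in (0 : ℝ)..L, z ξ := by
    intro z hz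
    have := intervalIntegral.sum_integral_adjacent_intervals (μ := volume) (f := z)
      (a := fun i : ℕ => (i : ℝ) * (L / n)) (n := n) (fun k hk =>
        hz.mono_set (hsub _ (hmem k hk.le) _ (hmem (k + 1) hk)))
    rw [this, hend]
    simp
  rw [← hsum _ hv2, ← hsum _ hw2, Finset.mul_sum]
  exact Finset.sum_le_sum hpiece

theorem intervalIntegrable_of_integrable_vol {L : ℝ} (hL : 0 < L) {φ : ℝ → ℝ}
    (h : Integrable φ (vol L)) : IntervalIntegrable φ volume 0 L := by
  rw [intervalIntegrable_iff_integrableOn_Ioo_of_le hL.le]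
  exact h

theorem integral_vol_eq {L : ℝ} (hL : 0 < L) (φ : ℝ → ℝ) :
    ∫ ξ, φ ξ ∂(vol L) = ∫ ξ in (0 : ℝ)..L, φ ξ := by
  rw [intervalIntegral.integral_of_le hL.le, integral_Ioc_eq_integral_Ioo]

/-- A linear map into a space of dimension `2n` has a nontrivial kernel on a space of larger
dimension. Here `u` and `v` will hold the values of eigenfunctions and of their derivatives at the
`n` nodes. -/
theorem exists_ne_zero_of_two_mul_lt_card {ι : Type*} [Fintype ι] {n : ℕ}
    (hn : 2 * n < Fintype.card ι) (u v : ι → Fin n → ℝ) :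
    ∃ c : ι → ℝ, c ≠ 0 ∧ (∀ i, ∑ k, c k * u k i = 0) ∧ ∀ i, ∑ k, c k * v k i = 0 := by
  let T : (ι → ℝ) →ₗ[ℝ] ((Fin n → ℝ) × (Fin n → ℝ)) :=
    (Fintype.linearCombination ℝ u).prod (Fintype.linearCombination ℝ v)
  have hlt : Module.finrank ℝ ((Fin n → ℝ) × (Fin n → ℝ)) < Module.finrank ℝ (ι → ℝ) := by
    simp; omega
  obtain ⟨c, hc, hc0⟩ := (Submodule.ne_bot_iff _).1 (LinearMap.ker_ne_bot_of_finrank_lt (f := T) hlt)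
  refine ⟨c, hc0, fun i => ?_, fun i => ?_⟩
  · have := congrFun (congrArg Prod.fst (LinearMap.mem_ker.1 hc)) i
    simpa [T, Fintype.linearCombination_apply, Finset.sum_apply] using this
  · have := congrFun (congrArg Prod.snd (LinearMap.mem_ker.1 hc)) i
    simpa [T, Fintype.linearCombination_apply, Finset.sum_apply] using this

theorem sq_integrable_H {L : ℝ} (x : H L) : Integrable (fun ξ => x ξ ^ 2) (vol L) :=
  (Lp.memLp x).integrable_sq

theorem norm_sq_H {L : ℝ} (x : H L) : ‖x‖ ^ 2 = ∫ ξ, x ξ ^ 2 ∂(vol L) := by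
  rw [← real_inner_self_eq_norm_sq, L2.inner_def]
  simp [pow_two]

theorem inner_H {L : ℝ} (x y : H L) : inner ℝ x y = ∫ ξ, x ξ * y ξ ∂(vol L) := by
  rw [L2.inner_def]
  simp [mul_comm]

theorem EllipticOp.exists_bound {L : ℝ} (hL : 0 < L) (B : EllipticOp L) :
    ∃ K : ℝ, 0 ≤ K ∧ ∀ ξ ∈ Set.Icc 0 L, B.b ξ ^ 2 ≤ K ∧ B.c ξ ^ 2 ≤ K := by
  obtain ⟨K₁, h₁⟩ := (isCompact_Icc.image_of_continuousOn (B.continuousOn_b.pow 2)).bddAbove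
  obtain ⟨K₂, h₂⟩ := (isCompact_Icc.image_of_continuousOn (B.continuousOn_c.pow 2)).bddAbove
  refine ⟨max K₁ K₂, ?_, fun ξ hξ => ⟨?_, ?_⟩⟩
  · exact (sq_nonneg (B.b 0)).trans ((h₁ ⟨0, ⟨le_rfl, hL.le⟩, rfl⟩).trans (le_max_left _ _))
  · exact (h₁ ⟨ξ, hξ, rfl⟩).trans (le_max_left _ _)
  · exact (h₂ ⟨ξ, hξ, rfl⟩).trans (le_max_right _ _)

theorem norm_sq_sum_basis {L : ℝ} (e : HilbertBasis ℕ ℝ (H L)) (S : Finset ℕ) (c : S → ℝ) :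
    ‖∑ k, c k • e k‖ ^ 2 = ∑ k, c k ^ 2 := by
  have h := (e.orthonormal.comp (fun k : S => (k : ℕ)) Subtype.val_injective).inner_sum c c
    Finset.univ
  rw [← real_inner_self_eq_norm_sq]
  simpa [pow_two] using h

/-- If a function in `W^{2,2}(0, L)` and its derivative vanish at the left end points of the pieces
of a fine equipartition, then the elliptic operator is large on it. -/
theorem EllipticOp.eq_zero_of_vanishing {L : ℝ} (hL : 0 < L) (B : EllipticOp L) {ν K Λ : ℝ}
    (hν : 0 < ν) (ha : ∀ ξ ∈ Set.Icc 0 L, ν ≤ B.a ξ)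
    (hK : ∀ ξ ∈ Set.Icc 0 L, B.b ξ ^ 2 ≤ K ∧ B.c ξ ^ 2 ≤ K) (hK0 : 0 ≤ K)
    {n : ℕ} (hn : 0 < n)
    (hsmall : 3 * (Λ ^ 2 * (L / n) ^ 4 + K * (L / n) ^ 2 + K * (L / n) ^ 4) < ν ^ 2)
    {v v' w : ℝ → ℝ} (hw : MemLp w 2 (vol L)) {x z : H L} (hx : x =ᵐ[vol L] v)
    (hz : z =ᵐ[vol L] fun ξ => B.a ξ * w ξ + B.b ξ * v' ξ + B.c ξ * v ξ)
    (hv : ∀ ξ ∈ Set.Icc 0 L, v ξ = v 0 + ∫ s in (0 : ℝ)..ξ, v' s)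
    (hv' : ∀ ξ ∈ Set.Icc 0 L, v' ξ = v' 0 + ∫ s in (0 : ℝ)..ξ, w s)
    (h0 : ∀ i < n, v (i * (L / n)) = 0) (h0' : ∀ i < n, v' (i * (L / n)) = 0)
    (hzx : ‖z‖ ^ 2 ≤ Λ ^ 2 * ‖x‖ ^ 2) : x = 0 := by
  have hwi : IntervalIntegrable w volume 0 L :=
    intervalIntegrable_of_integrable_vol hL (hw.integrable (by norm_num))
  have hw2 : IntervalIntegrable (fun s => w s ^ 2) volume 0 L :=
    intervalIntegrable_of_integrable_vol hL hw.integrable_sq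
  have hc' := continuousOn_of_eq_primitive hL hwi hv'
  have hv'i : IntervalIntegrable v' volume 0 L := hc'.intervalIntegrable
  have hv'2 : IntervalIntegrable (fun s => v' s ^ 2) volume 0 L := (hc'.pow 2).intervalIntegrable
  have hc := continuousOn_of_eq_primitive hL hv'i hv
  have hv2 : IntervalIntegrable (fun s => v s ^ 2) volume 0 L := (hc.pow 2).intervalIntegrable
  have e1 := intervalIntegral_sq_le_of_vanishing hL hwi hw2 hv' hn h0'
  have e2 := intervalIntegral_sq_le_of_vanishing hL hv'i hv'2 hv hn h0
  have hxn : ‖x‖ ^ 2 = ∫ ξ in (0 : ℝ)..L, v ξ ^ 2 := by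
    rw [norm_sq_H, ← integral_vol_eq hL]
    exact integral_congr_ae (hx.mono fun ξ h => by simp only [h])
  -- Solve the equation for `a w = z - b v' - c v`, then use `a ≥ ν` and `(z - p - q)² ≤ 3(z² + p² +
  -- q²)`, whose defect is `(z + p)² + (z + q)² + (p - q)²`.
  have hmain : ν ^ 2 * ∫ ξ in (0 : ℝ)..L, w ξ ^ 2 ≤ 3 * (‖z‖ ^ 2 +
      K * (∫ ξ in (0 : ℝ)..L, v' ξ ^ 2) + K * ∫ ξ in (0 : ℝ)..L, v ξ ^ 2) := by
    rw [norm_sq_H]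
    simp only [← integral_vol_eq hL]
    have i1 : Integrable (fun ξ => w ξ ^ 2) (vol L) := hw.integrable_sq
    have i2 : Integrable (fun ξ => v' ξ ^ 2) (vol L) :=
      (intervalIntegrable_iff_integrableOn_Ioo_of_le hL.le).1 hv'2
    have i3 : Integrable (fun ξ => v ξ ^ 2) (vol L) :=
      (intervalIntegrable_iff_integrableOn_Ioo_of_le hL.le).1 hv2
    have i4 := sq_integrable_H z
    have i4' : Integrable (fun ξ => z ξ ^ 2 + K * v' ξ ^ 2) (vol L) := i4.add (i2.const_mul K)
    have i5 : Integrable (fun ξ => z ξ ^ 2 + K * v' ξ ^ 2 + K * v ξ ^ 2) (vol L) :=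
      i4'.add (i3.const_mul K)
    rw [← integral_const_mul, ← integral_const_mul K, ← integral_const_mul K,
      ← integral_add i4 (i2.const_mul K), ← integral_add i4' (i3.const_mul K),
      ← integral_const_mul 3]
    refine integral_mono_ae (i1.const_mul _) (i5.const_mul 3) ?_
    filter_upwards [hz, ae_restrict_mem measurableSet_Ioo] with ξ hξ hm
    have hm' := Set.Ioo_subset_Icc_self hm
    obtain ⟨hb, hcc⟩ := hK ξ hm'
    have hνa := ha ξ hm'
    have t1 : ν ^ 2 * w ξ ^ 2 ≤ (B.a ξ * w ξ) ^ 2 := by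
      rw [mul_pow]
      exact mul_le_mul_of_nonneg_right (pow_le_pow_left₀ hν.le hνa 2) (sq_nonneg _)
    have t2 : B.a ξ * w ξ = z ξ - B.b ξ * v' ξ - B.c ξ * v ξ := by rw [hξ]; ring
    have t3 : (B.b ξ * v' ξ) ^ 2 ≤ K * v' ξ ^ 2 := by
      rw [mul_pow]; exact mul_le_mul_of_nonneg_right hb (sq_nonneg _)
    have t4 : (B.c ξ * v ξ) ^ 2 ≤ K * v ξ ^ 2 := by
      rw [mul_pow]; exact mul_le_mul_of_nonneg_right hcc (sq_nonneg _)
    rw [t2] at t1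
    generalize B.b ξ * v' ξ = p at *
    generalize B.c ξ * v ξ = q at *
    nlinarith [sq_nonneg (z ξ + p), sq_nonneg (z ξ + q), sq_nonneg (p - q)]
  have hW0 : 0 ≤ ∫ ξ in (0 : ℝ)..L, w ξ ^ 2 :=
    intervalIntegral.integral_nonneg hL.le fun s _ => sq_nonneg _
  set W := ∫ ξ in (0 : ℝ)..L, w ξ ^ 2
  set V' := ∫ ξ in (0 : ℝ)..L, v' ξ ^ 2
  have e3 : ‖x‖ ^ 2 ≤ (L / n) ^ 4 * W := by
    rw [hxn]
    refine e2.trans ?_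
    calc (L / n) ^ 2 * V' ≤ (L / n) ^ 2 * ((L / n) ^ 2 * W) :=
          mul_le_mul_of_nonneg_left e1 (sq_nonneg _)
      _ = _ := by ring
  rw [← hxn] at hmain
  -- The second derivative is bounded by a strict fraction of itself, so `W = 0`.
  have e4 : ν ^ 2 * W ≤ 3 * (Λ ^ 2 * (L / n) ^ 4 + K * (L / n) ^ 2 + K * (L / n) ^ 4) * W := by
    have := mul_le_mul_of_nonneg_left e3 (sq_nonneg Λ)
    have := mul_le_mul_of_nonneg_left e3 hK0
    have := mul_le_mul_of_nonneg_left e1 hK0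
    linarith
  have hWz : W = 0 := by
    by_contra hne
    have hpos : 0 < W := lt_of_le_of_ne hW0 (Ne.symm hne)
    exact absurd (le_of_mul_le_mul_right e4 hpos) (not_le.2 hsmall)
  rw [hWz, mul_zero] at e3
  have : ‖x‖ = 0 := by nlinarith [norm_nonneg x]
  exact norm_eq_zero.1 this

theorem coeFn_sum_smul {L : ℝ} {ι : Type*} (S : Finset ι) (c : ι → ℝ) (x : ι → H L) :
    (∑ k ∈ S, c k • x k : H L) =ᵐ[vol L] fun ξ => ∑ k ∈ S, c k * x k ξ := by
  classical
  induction S using Finset.induction_on with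
  | empty =>
    simp only [Finset.sum_empty]
    exact Lp.coeFn_zero ..
  | insert a S ha ih =>
    simp only [Finset.sum_insert ha]
    filter_upwards [Lp.coeFn_add (c a • x a) (∑ k ∈ S, c k • x k), ih,
      Lp.coeFn_smul (c a) (x a)] with ξ h1 h2 h3
    rw [h1, Pi.add_apply, h2, h3, Pi.smul_apply, smul_eq_mul]

theorem intervalIntegrable_of_subinterval {L ξ : ℝ} (hξ : ξ ∈ Set.Icc 0 L) {w : ℝ → ℝ}
    (hw : IntervalIntegrable w volume 0 L) : IntervalIntegrable w volume 0 ξ := by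
  refine hw.mono_set ?_
  rw [Set.uIcc_of_le hξ.1, Set.uIcc_of_le (hξ.1.trans hξ.2)]
  exact Set.Icc_subset_Icc_right hξ.2

/-- The eigenvalues grow at least quadratically. -/
theorem Diagonalizes.card_le {L : ℝ} (hL : 0 < L) {B : EllipticOp L} {e : HilbertBasis ℕ ℝ (H L)}
    {α : ℕ → ℝ} (hB : Diagonalizes B e α) :
    ∃ c₀ : ℝ, 0 < c₀ ∧ ∃ n₀ : ℕ, ∀ n ≥ n₀, ∀ S : Finset ℕ,
      (∀ k ∈ S, |α k| ≤ c₀ * n ^ 2) → S.card ≤ 2 * n := by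
  obtain ⟨ν, hν, ha⟩ := B.elliptic
  obtain ⟨K, hK0, hK⟩ := B.exists_bound hL
  choose u u' w hW _ _ heq using hB.eigen
  -- The lower bound on `n` makes the terms with `K` contribute less than `ν²/2` to `hsmall`, and
  -- `c₀ = ν / (4L²)` makes the term with `Λ` equal to `3ν²/16`; the sum stays below `ν²`.
  obtain ⟨m, hm⟩ := exists_nat_gt (6 * K * (L ^ 2 + L ^ 4) / ν ^ 2)
  refine ⟨ν / (4 * L ^ 2), by positivity, m + 1, fun n hn S hS => ?_⟩
  by_contra hcard
  have hn0 : 0 < n := by omega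
  obtain ⟨c, hc, hcu, hcu'⟩ := exists_ne_zero_of_two_mul_lt_card (ι := S) (n := n)
    (by simpa using hcard) (fun k i => u k (i * (L / n))) (fun k i => u' k (i * (L / n)))
  set Λ : ℝ := ν / (4 * L ^ 2) * n ^ 2 with hΛ
  have hn1 : (1 : ℝ) ≤ n := by exact_mod_cast hn0
  have hsmall : 3 * (Λ ^ 2 * (L / n) ^ 4 + K * (L / n) ^ 2 + K * (L / n) ^ 4) < ν ^ 2 := by
    have e1 : Λ ^ 2 * (L / n) ^ 4 = ν ^ 2 / 16 := by
      rw [hΛ]; field_simp; norm_num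
    have hmn : (m : ℝ) ≤ n := by exact_mod_cast (by omega : m ≤ n)
    have e2 : 6 * K * (L ^ 2 + L ^ 4) < ν ^ 2 * n := by
      have := (div_lt_iff₀ (by positivity : 0 < ν ^ 2)).1 (hm.trans_le hmn)
      linarith
    have e3 : K * (L / n) ^ 2 ≤ K * L ^ 2 / n := by
      rw [div_pow, mul_div_assoc]
      refine mul_le_mul_of_nonneg_left ?_ hK0
      exact div_le_div_of_nonneg_left (by positivity) (by positivity)
        (by nlinarith)
    have e4 : K * (L / n) ^ 4 ≤ K * L ^ 4 / n := by
      rw [div_pow, mul_div_assoc]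
      refine mul_le_mul_of_nonneg_left ?_ hK0
      exact div_le_div_of_nonneg_left (by positivity) (by positivity)
        (le_self_pow₀ hn1 (by norm_num))
    have e5 : K * L ^ 2 / n + K * L ^ 4 / n < ν ^ 2 / 6 := by
      rw [← add_div, div_lt_iff₀ (by positivity)]
      linarith
    have : 0 < ν ^ 2 := by positivity
    linarith
  have hui : ∀ k, IntervalIntegrable (w k) volume 0 L := fun k =>
    intervalIntegrable_of_integrable_vol hL ((Lp.memLp (w k)).integrable (by norm_num))
  have hu'i : ∀ k, IntervalIntegrable (u' k) volume 0 L := fun k =>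
    (continuousOn_of_eq_primitive hL (hui k) (hW k).deriv_eq_integral).intervalIntegrable
  have hprim : ∀ (p q : ℕ → ℝ → ℝ), (∀ k, IntervalIntegrable (q k) volume 0 L) →
      (∀ k, ∀ ξ ∈ Set.Icc 0 L, p k ξ = p k 0 + ∫ s in (0 : ℝ)..ξ, q k s) →
      ∀ ξ ∈ Set.Icc 0 L, ∑ k, c k * p k ξ =
        ∑ k, c k * p k 0 + ∫ s in (0 : ℝ)..ξ, ∑ k, c k * q k s := by
    intro p q hq hpq ξ hξ
    rw [intervalIntegral.integral_finsetSum (f := fun (k : S) s => c k * q k s) fun k _ =>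
      (intervalIntegrable_of_subinterval hξ (hq k)).const_mul _, ← Finset.sum_add_distrib]
    refine Finset.sum_congr rfl fun k _ => ?_
    rw [hpq k ξ hξ, intervalIntegral.integral_const_mul, mul_add]
  have hzero := B.eq_zero_of_vanishing hL hν ha hK hK0 hn0 hsmall
    (v := fun ξ => ∑ k, c k * u k ξ) (v' := fun ξ => ∑ k, c k * u' k ξ)
    (w := fun ξ => ∑ k, c k * w k ξ) (x := ∑ k, c k • e k) (z := ∑ k, c k • (-(α k) • e k))
    (memLp_finsetSum _ fun k _ => (Lp.memLp (w k)).const_mul _)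
    (by
      filter_upwards [coeFn_sum_smul Finset.univ c (fun k => e k),
        ae_all_iff.2 fun k => (hW k).ae_eq] with ξ h1 h2
      rw [h1]
      exact Finset.sum_congr rfl fun k _ => by rw [h2])
    (by
      filter_upwards [coeFn_sum_smul Finset.univ c (fun k => -(α k) • e k),
        ae_all_iff.2 heq] with ξ h1 h2
      rw [h1]
      simp only [Finset.mul_sum, ← Finset.sum_add_distrib]
      exact Finset.sum_congr rfl fun k _ => by rw [h2]; ring)
    (hprim u u' hu'i fun k => (hW k).eq_integral)
    (hprim u' (fun k => w k) hui fun k => (hW k).deriv_eq_integral)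
    (fun i hi => hcu ⟨i, hi⟩) (fun i hi => hcu' ⟨i, hi⟩)
    (by
      -- By orthonormality `B` acts on the combination with norm at most the largest `|αₖ|`, hence
      -- at most `Λ`.
      simp only [smul_smul]
      rw [norm_sq_sum_basis e S c, norm_sq_sum_basis e S fun k => c k * -(α k), Finset.mul_sum]
      refine Finset.sum_le_sum fun k _ => ?_
      have := sq_le_sq' (by linarith [abs_nonneg (α k), hS k k.2]) (hS k k.2)
      rw [sq_abs] at this
      nlinarith [mul_le_mul_of_nonneg_left this (sq_nonneg (c k))])
  have hs := norm_sq_sum_basis e S c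
  rw [hzero, norm_zero, zero_pow two_ne_zero, eq_comm,
    Finset.sum_eq_zero_iff_of_nonneg fun k _ => sq_nonneg _] at hs
  exact hc (funext fun k => pow_eq_zero_iff two_ne_zero |>.1 (hs k (Finset.mem_univ k)))

theorem Diagonalizes.lambda_le {L : ℝ} {B : EllipticOp L} {e : HilbertBasis ℕ ℝ (H L)}
    {α : ℕ → ℝ} (hB : Diagonalizes B e α) (k : ℕ) : ⨅ k, α k ≤ α k := by
  refine ciInf_le ?_ k
  by_contra h
  exact hB.pos.ne' (Real.iInf_of_not_bddBelow h)

/-- `(-B)⁻¹` is a trace class operator. -/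
theorem Diagonalizes.summable_inv {L : ℝ} (hL : 0 < L) {B : EllipticOp L}
    {e : HilbertBasis ℕ ℝ (H L)} {α : ℕ → ℝ} (hB : Diagonalizes B e α) :
    Summable fun k => (α k)⁻¹ := by
  obtain ⟨c₀, hc₀, n₀, hcard⟩ := hB.card_le hL
  have hpos : ∀ k, 0 < α k := fun k => hB.pos.trans_le (hB.lambda_le k)
  obtain ⟨j₀, hj₀⟩ : ∃ j₀ : ℕ, n₀ ≤ 2 ^ j₀ := ⟨n₀, Nat.lt_two_pow_self.le⟩
  set lam := ⨅ k, α k with hlam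
  have hlam0 : 0 < lam := hB.pos
  -- Dyadic layers: at most `2 · 2^(j₀ + j)` indices have `αₖ ≤ T j`, while `T j` grows like `4 ^
  -- j`. If `j` is the first layer containing `k`, then `1/αₖ` is at most a constant over `T j`, so
  -- layer `j` contributes `O(2⁻ʲ)`.
  set T : ℕ → ℝ := fun j => c₀ * ((2 ^ (j₀ + j) : ℕ) : ℝ) ^ 2 with hT
  have hTpos : ∀ j, 0 < T j := fun j => by positivity
  have hTs : ∀ j, T (j + 1) = 4 * T j := fun j => by
    simp only [hT]; push_cast; ring
  -- For a first layer `j + 1`, minimality gives `αₖ > T j = T (j + 1) / 4`; for layer `0` the only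
  -- lower bound is `αₖ ≥ lam`.
  set K : ℝ := max 4 (T 0 / lam) with hK
  have hK0 : 0 < K := lt_of_lt_of_le (by norm_num) (le_max_left _ _)
  have hex : ∀ k, ∃ j, α k ≤ T j := by
    intro k
    obtain ⟨m, hm⟩ := exists_nat_gt (α k / c₀)
    refine ⟨m, ?_⟩
    have h1 : (m : ℝ) ≤ ((2 ^ (j₀ + m) : ℕ) : ℝ) := by
      exact_mod_cast Nat.lt_two_pow_self.le.trans (Nat.pow_le_pow_right (by norm_num) (by omega))
    have h2 : (1 : ℝ) ≤ ((2 ^ (j₀ + m) : ℕ) : ℝ) := by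
      exact_mod_cast Nat.one_le_two_pow
    have h3 := (div_lt_iff₀ hc₀).1 hm
    have h4 : (m : ℝ) ≤ ((2 ^ (j₀ + m) : ℕ) : ℝ) ^ 2 := by nlinarith
    have h5 := mul_le_mul_of_nonneg_left h4 hc₀.le
    simp only [hT]
    linarith
  have hlayer : ∀ k, ∃ j, α k ≤ T j ∧ (α k)⁻¹ ≤ K * (T j)⁻¹ := by
    intro k
    classical
    refine ⟨Nat.find (hex k), Nat.find_spec (hex k), ?_⟩
    have hle : T (Nat.find (hex k)) ≤ K * α k := by
      rcases hj : Nat.find (hex k) with _ | j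
      · have : T 0 / lam * lam ≤ K * α k :=
          mul_le_mul (le_max_right _ _) (hB.lambda_le k) hlam0.le hK0.le
        rwa [div_mul_cancel₀ _ hlam0.ne'] at this
      · have h1 := Nat.find_min (hex k) (m := j) (by omega)
        rw [hTs]
        exact mul_le_mul (le_max_left _ _) (not_le.1 h1).le (hTpos j).le hK0.le
    rw [inv_eq_one_div, ← div_eq_mul_inv, div_le_div_iff₀ (hpos k) (hTpos _)]
    linarith
  choose J hJ1 hJ2 using hlayer
  have hgeo : Summable fun j : ℕ => (2 * K * 2 ^ j₀ / T 0) * (1 / 2 : ℝ) ^ j :=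
    summable_geometric_two.mul_left _
  refine summable_of_sum_le (c := ∑' j : ℕ, (2 * K * 2 ^ j₀ / T 0) * (1 / 2 : ℝ) ^ j)
    (fun k => (inv_pos.2 (hpos k)).le) fun S => ?_
  classical
  calc ∑ k ∈ S, (α k)⁻¹ ≤ ∑ k ∈ S, K * (T (J k))⁻¹ := Finset.sum_le_sum fun k _ => hJ2 k
    _ = ∑ j ∈ S.image J, ∑ k ∈ S with J k = j, K * (T (J k))⁻¹ :=
        (Finset.sum_fiberwise_of_maps_to (fun k hk => Finset.mem_image_of_mem J hk) _).symm
    _ ≤ ∑ j ∈ S.image J, (2 * K * 2 ^ j₀ / T 0) * (1 / 2 : ℝ) ^ j := by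
        refine Finset.sum_le_sum fun j _ => ?_
        have h1 : ∑ k ∈ S with J k = j, K * (T (J k))⁻¹ =
            ((S.filter fun k => J k = j).card : ℝ) * (K * (T j)⁻¹) := by
          rw [← nsmul_eq_mul, ← Finset.sum_const]
          exact Finset.sum_congr rfl fun k hk => by rw [(Finset.mem_filter.1 hk).2]
        have h2 := hcard (2 ^ (j₀ + j))
          (hj₀.trans (Nat.pow_le_pow_right (by norm_num) (by omega)))
          (S.filter fun k => J k = j) fun k hk => by
            rw [abs_of_pos (hpos k), ← (Finset.mem_filter.1 hk).2]
            exact hJ1 k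
        have h3 : ((S.filter fun k => J k = j).card : ℝ) ≤ 2 * 2 ^ (j₀ + j) := by
          exact_mod_cast h2
        have hTj : T j = T 0 * 4 ^ j := by
          simp only [hT]; push_cast
          rw [show (4 : ℝ) ^ j = 2 ^ j * 2 ^ j by rw [← mul_pow]; norm_num, pow_add]; ring
        rw [h1]
        refine (mul_le_mul_of_nonneg_right h3 (mul_pos hK0 (inv_pos.2 (hTpos j))).le).trans_eq ?_
        rw [hTj, show (4 : ℝ) ^ j = 2 ^ j * 2 ^ j by rw [← mul_pow]; norm_num, pow_add, one_div,
          inv_pow]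
        have := (hTpos 0).ne'
        field_simp
    _ ≤ _ := hgeo.sum_le_tsum _ fun j _ => by
        have := hTpos 0
        positivity

/-! ### The Gaussian measure -/

theorem lintegral_exp_mul_sq_gaussianReal {s : ℝ} (hs : s < 1 / 2) :
    ∫⁻ x, ENNReal.ofReal (Real.exp (s * x ^ 2)) ∂(gaussianReal 0 1) =
      ENNReal.ofReal (√(1 - 2 * s)⁻¹) := by
  have hb : 0 < 1 / 2 - s := by linarith
  rw [gaussianReal_of_var_ne_zero _ one_ne_zero,
    lintegral_withDensity_eq_lintegral_mul _ (measurable_gaussianPDF 0 1)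
      (by fun_prop : Measurable fun x : ℝ => ENNReal.ofReal (Real.exp (s * x ^ 2)))]
  have h : ∀ x : ℝ, (gaussianPDF 0 1 * fun x : ℝ => ENNReal.ofReal (Real.exp (s * x ^ 2))) x =
      ENNReal.ofReal ((√(2 * Real.pi))⁻¹ * Real.exp (-(1 / 2 - s) * x ^ 2)) := by
    intro x
    rw [Pi.mul_apply, gaussianPDF, ← ENNReal.ofReal_mul (gaussianPDFReal_nonneg _ _ _),
      gaussianPDFReal]
    simp only [NNReal.coe_one, mul_one, sub_zero]
    rw [mul_assoc, ← Real.exp_add]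
    congr 3
    ring
  simp_rw [h]
  rw [← ofReal_integral_eq_lintegral_ofReal ((integrable_exp_neg_mul_sq hb).const_mul _)
    (Filter.Eventually.of_forall fun x => by positivity), integral_const_mul, integral_gaussian]
  congr 1
  rw [← Real.sqrt_inv, ← Real.sqrt_mul (by positivity)]
  congr 1
  have := Real.pi_ne_zero
  have : 1 - 2 * s ≠ 0 := by linarith
  field_simp

/-- Turns each factor `(1 - c/αₖ)^{-1/2}` of the Gaussian moment into an exponential, so that the
product is controlled by `∑ 1/αₖ`. The square root may be dropped because the bound is at least `1`.
-/
theorem sqrt_inv_one_sub_le_exp {t r : ℝ} (ht : 0 ≤ t) (htr : t ≤ r) (hr : r < 1) :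
    √(1 - t)⁻¹ ≤ Real.exp (t / (1 - r)) := by
  have h1 : 0 < 1 - t := by linarith
  have h2 : 0 < 1 - r := by linarith
  have hle : t / (1 - t) ≤ t / (1 - r) := div_le_div_of_nonneg_left ht h2 (by linarith)
  have h3 : (1 - t)⁻¹ ≤ Real.exp (t / (1 - r)) := by
    refine le_trans ?_ (Real.add_one_le_exp _)
    have : (1 - t)⁻¹ = t / (1 - t) + 1 := by field_simp; ring
    linarith
  have h4 : 1 ≤ Real.exp (t / (1 - r)) := Real.one_le_exp (by positivity)
  rw [Real.sqrt_le_left (by positivity)]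
  nlinarith

/-- The law of a sequence of independent standard normal variables. -/
noncomputable abbrev stdSeq : Measure (ℕ → ℝ) := Measure.infinitePi fun _ : ℕ => gaussianReal 0 1

/-- The squared norm of the partial sums of the Karhunen-Loève series. -/
noncomputable def klSq (α : ℕ → ℝ) (n : ℕ) (ζ : ℕ → ℝ) : ℝ :=
  ∑ k ∈ Finset.range n, (ζ k / √(2 * α k)) ^ 2

theorem measurable_klSq (α : ℕ → ℝ) (n : ℕ) : Measurable (klSq α n) := by
  unfold klSq; fun_prop

theorem klSq_mono (α : ℕ → ℝ) (ζ : ℕ → ℝ) : Monotone fun n => klSq α n ζ := by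
  refine monotone_nat_of_le_succ fun n => ?_
  simp only [klSq, Finset.sum_range_succ]
  linarith [sq_nonneg (ζ n / √(2 * α n))]

/-- The coordinates are independent, so the moment factorizes into one-dimensional Gaussian
integrals, finite since `c < lam ≤ αₖ`. The bound does not depend on `n`. -/
theorem lintegral_exp_klSq_le {α : ℕ → ℝ} {lam c : ℝ} (hlam : ∀ k, lam ≤ α k) (hc : 0 ≤ c)
    (hclam : c < lam) (hsum : Summable fun k => (α k)⁻¹) (n : ℕ) :
    ∫⁻ ζ, ENNReal.ofReal (Real.exp (c * klSq α n ζ)) ∂stdSeq ≤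
      ENNReal.ofReal (Real.exp (c / (1 - c / lam) * ∑' k, (α k)⁻¹)) := by
  have hl0 : 0 < lam := hc.trans_lt hclam
  have hα : ∀ k, 0 < α k := fun k => hl0.trans_le (hlam k)
  have hr : c / lam < 1 := (div_lt_one hl0).2 hclam
  have hind : iIndepFun
      (fun (k : ℕ) (ζ : ℕ → ℝ) => ENNReal.ofReal (Real.exp (c / (2 * α k) * ζ k ^ 2))) stdSeq :=
    iIndepFun_infinitePi (P := fun _ : ℕ => gaussianReal 0 1)
      (X := fun (k : ℕ) (x : ℝ) => ENNReal.ofReal (Real.exp (c / (2 * α k) * x ^ 2)))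
      fun k => by fun_prop
  have hprod : ∀ ζ, ENNReal.ofReal (Real.exp (c * klSq α n ζ)) =
      ∏ k ∈ Finset.range n, ENNReal.ofReal (Real.exp (c / (2 * α k) * ζ k ^ 2)) := by
    intro ζ
    rw [← ENNReal.ofReal_prod_of_nonneg fun _ _ => (Real.exp_pos _).le, ← Real.exp_sum, klSq,
      Finset.mul_sum]
    congr 2
    refine Finset.sum_congr rfl fun k _ => ?_
    rw [div_pow, Real.sq_sqrt (by have := hα k; positivity)]
    ring
  simp_rw [hprod]
  rw [lintegral_prod_eq_prod_lintegral_of_indepFun _ _ hind fun k => by fun_prop]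
  have hone : ∀ k, ∫⁻ ζ : ℕ → ℝ, ENNReal.ofReal (Real.exp (c / (2 * α k) * ζ k ^ 2)) ∂stdSeq ≤
      ENNReal.ofReal (Real.exp (c / (1 - c / lam) * (α k)⁻¹)) := by
    intro k
    have hmp := measurePreserving_eval_infinitePi (fun _ : ℕ => gaussianReal 0 1) k
    have := hmp.lintegral_comp (f := fun x : ℝ =>
      ENNReal.ofReal (Real.exp (c / (2 * α k) * x ^ 2))) (by fun_prop)
    simp only [Function.eval] at this
    have hck : c / α k ≤ c / lam := div_le_div_of_nonneg_left hc hl0 (hlam k)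
    have hck0 : 0 ≤ c / α k := div_nonneg hc (hα k).le
    have e2 : 2 * (c / (2 * α k)) = c / α k := by field_simp
    rw [this, lintegral_exp_mul_sq_gaussianReal (by linarith), e2]
    refine ENNReal.ofReal_le_ofReal ((sqrt_inv_one_sub_le_exp hck0 hck hr).trans_eq ?_)
    congr 1
    rw [div_div, mul_comm, ← div_div]; ring
  refine (Finset.prod_le_prod' fun k _ => hone k).trans ?_
  rw [← ENNReal.ofReal_prod_of_nonneg fun _ _ => (Real.exp_pos _).le, ← Real.exp_sum,
    ← Finset.mul_sum]
  refine ENNReal.ofReal_le_ofReal (Real.exp_le_exp.2 (mul_le_mul_of_nonneg_left ?_ ?_))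
  · exact hsum.sum_le_tsum _ fun k _ => (inv_pos.2 (hα k)).le
  · exact div_nonneg hc (by linarith)

/-- Monotone convergence. Keeping the supremum inside the integral gives both the almost sure
convergence of the series and the exponential moment of its sum. -/
theorem lintegral_iSup_exp_klSq_lt_top {α : ℕ → ℝ} {lam c : ℝ} (hlam : ∀ k, lam ≤ α k)
    (hc : 0 ≤ c) (hclam : c < lam) (hsum : Summable fun k => (α k)⁻¹) :
    ∫⁻ ζ, ⨆ n, ENNReal.ofReal (Real.exp (c * klSq α n ζ)) ∂stdSeq < ⊤ := by
  rw [lintegral_iSup]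
  · exact (iSup_le fun n => lintegral_exp_klSq_le hlam hc hclam hsum n).trans_lt
      ENNReal.ofReal_lt_top
  · intro n
    have := measurable_klSq α n
    fun_prop
  · intro m n hmn ζ
    exact ENNReal.ofReal_le_ofReal (Real.exp_le_exp.2
      (mul_le_mul_of_nonneg_left (klSq_mono α ζ hmn) hc))

/-- A function with finite integral is almost surely finite, and a finite supremum of `exp(lam/2 ·
klSq)` bounds the partial sums. -/
theorem ae_summable_klSq {α : ℕ → ℝ} {lam : ℝ} (hl0 : 0 < lam) (hlam : ∀ k, lam ≤ α k)
    (hsum : Summable fun k => (α k)⁻¹) :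
    ∀ᵐ ζ ∂stdSeq, Summable fun k => (ζ k / √(2 * α k)) ^ 2 := by
  have hfin := lintegral_iSup_exp_klSq_lt_top hlam (half_pos hl0).le (half_lt_self hl0) hsum
  have hae := ae_lt_top' (μ := stdSeq) (f := fun ζ => ⨆ n, ENNReal.ofReal
    (Real.exp (lam / 2 * klSq α n ζ))) (by
      refine (Measurable.iSup fun n => ?_).aemeasurable
      have := measurable_klSq α n
      fun_prop) hfin.ne
  filter_upwards [hae] with ζ hζ
  refine summable_of_sum_range_le (c := (⨆ n, ENNReal.ofReal
    (Real.exp (lam / 2 * klSq α n ζ))).toReal / (lam / 2)) (fun k => sq_nonneg _) fun n => ?_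
  rw [le_div_iff₀ (half_pos hl0)]
  have h1 : ENNReal.ofReal (Real.exp (lam / 2 * klSq α n ζ)) ≤ _ := le_iSup
    (fun n => ENNReal.ofReal (Real.exp (lam / 2 * klSq α n ζ))) n
  have h2 := ENNReal.toReal_mono hζ.ne h1
  rw [ENNReal.toReal_ofReal (Real.exp_pos _).le] at h2
  have h3 := Real.add_one_le_exp (lam / 2 * klSq α n ζ)
  have h4 : klSq α n ζ = ∑ k ∈ Finset.range n, (ζ k / √(2 * α k)) ^ 2 := rfl
  rw [← h4]
  linarith

theorem norm_sq_sum_range_basis {L : ℝ} (e : HilbertBasis ℕ ℝ (H L)) (n : ℕ) (c : ℕ → ℝ) :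
    ‖∑ k ∈ Finset.range n, c k • e k‖ ^ 2 = ∑ k ∈ Finset.range n, c k ^ 2 := by
  rw [← real_inner_self_eq_norm_sq, e.orthonormal.inner_sum]
  simp [pow_two]

/-- The Karhunen-Loève series. -/
noncomputable def klSeries {L : ℝ} (e : HilbertBasis ℕ ℝ (H L)) (α : ℕ → ℝ) (ζ : ℕ → ℝ) : H L :=
  ∑' k, (ζ k / √(2 * α k)) • e k

theorem tendsto_klSeries {L : ℝ} (e : HilbertBasis ℕ ℝ (H L)) {α : ℕ → ℝ} {ζ : ℕ → ℝ}
    (h : Summable fun k => (ζ k / √(2 * α k)) ^ 2) :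
    Filter.Tendsto (fun n => ∑ k ∈ Finset.range n, (ζ k / √(2 * α k)) • e k) Filter.atTop
      (nhds (klSeries e α ζ)) := by
  refine HasSum.tendsto_sum_nat (Summable.hasSum ?_)
  have := (e.orthonormal.orthogonalFamily.summable_iff_norm_sq_summable
    (fun k => ζ k / √(2 * α k))).2 (by simpa only [Real.norm_eq_abs, sq_abs] using h)
  simpa using this

theorem exp_norm_sq_klSeries_le {L : ℝ} (e : HilbertBasis ℕ ℝ (H L)) {α : ℕ → ℝ} {ζ : ℕ → ℝ}
    (h : Summable fun k => (ζ k / √(2 * α k)) ^ 2) (c : ℝ) :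
    ENNReal.ofReal (Real.exp (c * ‖klSeries e α ζ‖ ^ 2)) ≤
      ⨆ n, ENNReal.ofReal (Real.exp (c * klSq α n ζ)) := by
  have h1 : Filter.Tendsto (fun n => ENNReal.ofReal (Real.exp (c * klSq α n ζ))) Filter.atTop
      (nhds (ENNReal.ofReal (Real.exp (c * ‖klSeries e α ζ‖ ^ 2)))) := by
    have h2 := ((tendsto_klSeries e h).norm.pow 2).const_mul c
    simp only [norm_sq_sum_range_basis] at h2
    exact ENNReal.tendsto_ofReal ((Real.continuous_exp.tendsto _).comp h2)
  exact le_of_tendsto' h1 fun n => le_iSup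
    (fun n => ENNReal.ofReal (Real.exp (c * klSq α n ζ))) n

theorem aemeasurable_klSeries {L : ℝ} (e : HilbertBasis ℕ ℝ (H L)) {α : ℕ → ℝ} {lam : ℝ}
    (hl0 : 0 < lam) (hlam : ∀ k, lam ≤ α k) (hsum : Summable fun k => (α k)⁻¹) :
    AEMeasurable (klSeries e α) stdSeq := by
  refine aemeasurable_of_tendsto_metrizable_ae Filter.atTop
    (f := fun (n : ℕ) (ζ : ℕ → ℝ) => ∑ k ∈ Finset.range n, (ζ k / √(2 * α k)) • e k)
    (fun n => ?_) ((ae_summable_klSq hl0 hlam hsum).mono fun ζ hζ => tendsto_klSeries e hζ)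
  refine (Continuous.measurable ?_).aemeasurable
  fun_prop

theorem isProbabilityMeasure_gaussian {L : ℝ} (e : HilbertBasis ℕ ℝ (H L)) {α : ℕ → ℝ} {lam : ℝ}
    (hl0 : 0 < lam) (hlam : ∀ k, lam ≤ α k) (hsum : Summable fun k => (α k)⁻¹) :
    IsProbabilityMeasure (gaussian e α) :=
  Measure.isProbabilityMeasure_map (aemeasurable_klSeries e hl0 hlam hsum)

/-- The sharp form of Fernique's theorem for `N(0, (-B)⁻¹/2)`. -/
theorem integrable_exp_norm_sq_gaussian {L : ℝ} (e : HilbertBasis ℕ ℝ (H L)) {α : ℕ → ℝ}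
    {lam c : ℝ} (hlam : ∀ k, lam ≤ α k) (hc : 0 ≤ c) (hclam : c < lam)
    (hsum : Summable fun k => (α k)⁻¹) :
    Integrable (fun y => Real.exp (c * ‖y‖ ^ 2)) (gaussian e α) := by
  have hl0 := hc.trans_lt hclam
  have hcont : Continuous fun y : H L => Real.exp (c * ‖y‖ ^ 2) := by fun_prop
  refine ⟨hcont.aestronglyMeasurable, ?_⟩
  rw [hasFiniteIntegral_iff_ofReal (Filter.Eventually.of_forall fun _ => (Real.exp_pos _).le)]
  change ∫⁻ y, _ ∂(Measure.map (klSeries e α) stdSeq) < ⊤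
  rw [lintegral_map' (by fun_prop) (aemeasurable_klSeries e hl0 hlam hsum)]
  refine lt_of_le_of_lt (lintegral_mono_ae ?_)
    (lintegral_iSup_exp_klSq_lt_top hlam hc hclam hsum)
  filter_upwards [ae_summable_klSq hl0 hlam hsum] with ζ hζ
  exact exp_norm_sq_klSeries_le e hζ c

open Filter Topology

instance instSecondCountableTopologyH (L : ℝ) : SecondCountableTopology (H L) := by
  have : Fact ((2 : ENNReal) ≠ ⊤) := ⟨by norm_num⟩
  infer_instance

/-! ### Integral functionals on `L²` -/

section Functional

variable {Ω : Type*} [MeasurableSpace Ω] {μ : Measure Ω}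

theorem norm_sq_toLp {φ : Ω → ℝ} (hφ : MemLp φ 2 μ) :
    ‖hφ.toLp φ‖ ^ 2 = ∫ ω, φ ω ^ 2 ∂μ := by
  rw [← real_inner_self_eq_norm_sq, L2.inner_def]
  refine integral_congr_ae (hφ.coeFn_toLp.mono fun ω h => ?_)
  simp [h, pow_two]

theorem tendsto_norm_toLp_zero {φ : ℕ → Ω → ℝ} (hφ : ∀ n, MemLp (φ n) 2 μ) {b : Ω → ℝ}
    (hb : MemLp b 2 μ) (hle : ∀ n, ∀ᵐ ω ∂μ, |φ n ω| ≤ b ω)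
    (hlim : ∀ᵐ ω ∂μ, Tendsto (fun n => φ n ω) atTop (𝓝 0)) :
    Tendsto (fun n => ‖(hφ n).toLp (φ n)‖) atTop (𝓝 0) := by
  have h1 : Tendsto (fun n => ∫ ω, φ n ω ^ 2 ∂μ) atTop (𝓝 (∫ _, (0 : ℝ) ∂μ)) := by
    refine tendsto_integral_of_dominated_convergence (fun ω => b ω ^ 2)
      (fun n => (hφ n).aestronglyMeasurable.pow 2) hb.integrable_sq (fun n => ?_) ?_
    · filter_upwards [hle n] with ω h
      rw [Real.norm_eq_abs, abs_pow]
      exact pow_le_pow_left₀ (abs_nonneg _) h 2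
    · filter_upwards [hlim] with ω h
      simpa using h.pow 2
  rw [integral_zero] at h1
  have h2 := (Real.continuous_sqrt.tendsto 0).comp h1
  rw [Real.sqrt_zero] at h2
  refine h2.congr fun n => ?_
  rw [Function.comp_apply, ← norm_sq_toLp (hφ n), Real.sqrt_sq (norm_nonneg _)]

/-- The derivative is an almost everywhere limit of difference quotients with increments `1/(n +
1)`, which are measurable by the joint measurability of `φ`. -/
theorem aestronglyMeasurable_deriv_comp {φ : Ω → ℝ → ℝ} (hφ : Measurable (Function.uncurry φ))
    {X : Ω → ℝ} (hX : AEMeasurable X μ) (hd : ∀ᵐ ω ∂μ, DifferentiableAt ℝ (φ ω) (X ω)) :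
    AEStronglyMeasurable (fun ω => deriv (φ ω) (X ω)) μ := by
  have hs : Tendsto (fun n : ℕ => 1 / ((n : ℝ) + 1)) atTop (𝓝[≠] 0) :=
    tendsto_nhdsWithin_iff.2 ⟨tendsto_one_div_add_atTop_nhds_zero_nat,
      Eventually.of_forall fun n => by simp only [Set.mem_compl_iff, Set.mem_singleton_iff]; positivity⟩
  refine aestronglyMeasurable_of_tendsto_ae atTop (f := fun (n : ℕ) ω =>
    (1 / ((n : ℝ) + 1))⁻¹ * (φ ω (X ω + 1 / ((n : ℝ) + 1)) - φ ω (X ω))) (fun n => ?_) ?_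
  · refine AEMeasurable.aestronglyMeasurable (AEMeasurable.const_mul (AEMeasurable.sub ?_ ?_) _)
    · exact hφ.comp_aemeasurable (aemeasurable_id.prodMk (hX.add_const _))
    · exact hφ.comp_aemeasurable (aemeasurable_id.prodMk hX)
  · filter_upwards [hd] with ω hω
    exact (hasDerivAt_iff_tendsto_slope_zero.1 hω.hasDerivAt).comp hs

theorem abs_deriv_le_of_lip {φ : ℝ → ℝ} {b : ℝ} (hb : 0 ≤ b)
    (h : ∀ s t, |φ s - φ t| ≤ b * |s - t|) (s : ℝ) : |deriv φ s| ≤ b := by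
  have hl : LipschitzWith ⟨b, hb⟩ φ := LipschitzWith.of_dist_le_mul fun s t => h s t
  exact norm_deriv_le_of_lipschitz hl

theorem nonneg_of_lip {φ : ℝ → ℝ} {b : ℝ} (h : ∀ s t, |φ s - φ t| ≤ b * |s - t|) : 0 ≤ b := by
  have := (abs_nonneg _).trans (h 1 0)
  simpa using this

/-- Fréchet differentiability of an integral functional whose integrand is Lipschitz continuous,
with square integrable Lipschitz constant, and differentiable at almost every point. -/
theorem differentiableAt_integral_comp {φ : Ω → ℝ → ℝ}
    (hφ : Measurable (Function.uncurry φ)) {b : Ω → ℝ} (hb : MemLp b 2 μ)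
    (hlip : ∀ᵐ ω ∂μ, ∀ s t, |φ ω s - φ ω t| ≤ b ω * |s - t|)
    (h0 : Integrable (fun ω => φ ω 0) μ) (X : Lp ℝ 2 μ)
    (hd : ∀ᵐ ω ∂μ, DifferentiableAt ℝ (φ ω) (X ω)) :
    DifferentiableAt ℝ (fun Y : Lp ℝ 2 μ => ∫ ω, φ ω (Y ω) ∂μ) X := by
  have hmeas : ∀ Y : Lp ℝ 2 μ, AEMeasurable Y μ :=
    fun Y => (Lp.aestronglyMeasurable Y).aemeasurable
  have hφm : ∀ Y : Lp ℝ 2 μ, AEStronglyMeasurable (fun ω => φ ω (Y ω)) μ := fun Y =>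
    (hφ.comp_aemeasurable (aemeasurable_id.prodMk (hmeas Y))).aestronglyMeasurable
  have hint : ∀ Y : Lp ℝ 2 μ, Integrable (fun ω => φ ω (Y ω)) μ := by
    intro Y
    have hbY : Integrable (fun ω => b ω * |Y ω|) μ :=
      MemLp.integrable_mul hb (Lp.memLp Y).abs
    refine (h0.abs.add hbY).mono' (hφm Y) ?_
    filter_upwards [hlip] with ω h
    have := h (Y ω) 0
    rw [sub_zero] at this
    rw [Real.norm_eq_abs, Pi.add_apply]
    linarith [abs_sub_abs_le_abs_sub (φ ω (Y ω)) (φ ω 0)]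
  set d : Ω → ℝ := fun ω => deriv (φ ω) (X ω) with hdd
  have hdm : AEStronglyMeasurable d μ := aestronglyMeasurable_deriv_comp hφ (hmeas X) hd
  have hdb : ∀ᵐ ω ∂μ, |d ω| ≤ b ω := hlip.mono fun ω h =>
    abs_deriv_le_of_lip (nonneg_of_lip h) h _
  have hdL : MemLp d 2 μ := hb.mono' hdm hdb
  refine HasFDerivAt.differentiableAt (f' := innerSL ℝ (hdL.toLp d)) ?_
  rw [hasFDerivAt_iff_tendsto]
  -- Convergence in `L²` gives pointwise convergence only along a subsequence, and it is enough to
  -- find one for every sequence.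
  refine tendsto_of_subseq_tendsto fun Y hY => ?_
  obtain ⟨ms, -, hae⟩ := (tendstoInMeasure_of_tendsto_Lp hY).exists_seq_tendsto_ae
  refine ⟨ms, ?_⟩
  -- The pointwise remainder divided by the increment. Where the increment vanishes, division by
  -- zero gives `0`, which is consistent since the remainder vanishes there too.
  set σ : ℕ → Ω → ℝ := fun i ω =>
    (φ ω (Y (ms i) ω) - φ ω (X ω) - d ω * (Y (ms i) ω - X ω)) / (Y (ms i) ω - X ω) with hσ
  have hσle : ∀ i, ∀ᵐ ω ∂μ, |σ i ω| ≤ 2 * b ω := by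
    intro i
    filter_upwards [hlip, hdb] with ω h1 h2
    have hb0 := nonneg_of_lip h1
    rw [hσ]
    simp only
    rw [abs_div]
    refine div_le_of_le_mul₀ (abs_nonneg _) (by linarith) ?_
    refine (abs_sub _ _).trans ?_
    rw [abs_mul]
    have := mul_le_mul_of_nonneg_right h2 (abs_nonneg (Y (ms i) ω - X ω))
    linarith [h1 (Y (ms i) ω) (X ω)]
  have hσm : ∀ i, AEStronglyMeasurable (σ i) μ := fun i =>
    (((hφm _).sub (hφm X)).aemeasurable.sub (hdm.aemeasurable.mul
      ((hmeas (Y (ms i))).sub (hmeas X)))).div ((hmeas (Y (ms i))).sub (hmeas X))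
      |>.aestronglyMeasurable
  have hσL : ∀ i, MemLp (σ i) 2 μ := fun i => (hb.const_mul 2).mono' (hσm i) (hσle i)
  have hσ0 : ∀ᵐ ω ∂μ, Tendsto (fun i => σ i ω) atTop (𝓝 0) := by
    filter_upwards [hd, hae] with ω h1 h2
    have h3 := (hasDerivAt_iff_tendsto.1 h1.hasDerivAt).comp h2
    rw [tendsto_zero_iff_abs_tendsto_zero]
    refine h3.congr fun i => ?_
    simp only [hσ, Function.comp_apply, smul_eq_mul, abs_div, Real.norm_eq_abs]
    rw [div_eq_inv_mul, mul_comm (d ω)]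
  have hlim := tendsto_norm_toLp_zero hσL (hb.const_mul 2) hσle hσ0
  refine squeeze_zero (fun i => by positivity) (fun i => ?_) hlim
  -- The whole remainder is the inner product of `σ` with the increment. Cauchy–Schwarz therefore
  -- leaves `‖σ‖`, uniformly in the direction: this is what gives Fréchet differentiability.
  have hkey : (∫ ω, φ ω (Y (ms i) ω) ∂μ) - (∫ ω, φ ω (X ω) ∂μ) -
      innerSL ℝ (hdL.toLp d) (Y (ms i) - X) =
      inner ℝ ((hσL i).toLp (σ i)) (Y (ms i) - X) := by
    rw [innerSL_apply_apply, L2.inner_def, L2.inner_def, ← integral_sub (hint _) (hint X),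
      ← integral_sub (f := fun ω => φ ω (Y (ms i) ω) - φ ω (X ω)) ((hint _).sub (hint X))
        (L2.integrable_inner _ _)]
    refine integral_congr_ae ?_
    filter_upwards [hdL.coeFn_toLp, (hσL i).coeFn_toLp, Lp.coeFn_sub (Y (ms i)) X]
      with ω h1 h2 h3
    simp only [h1, h2, h3, Pi.sub_apply, RCLike.inner_apply, conj_trivial]
    by_cases hz : Y (ms i) ω - X ω = 0
    · rw [hz, sub_eq_zero.1 hz]; simp
    · simp only [hσ]; field_simp
  rw [hkey]
  have hcs := norm_inner_le_norm (𝕜 := ℝ) ((hσL i).toLp (σ i)) (Y (ms i) - X)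
  rcases eq_or_ne ‖Y (ms i) - X‖ 0 with hz | hz
  · rw [hz, inv_zero, zero_mul]; exact norm_nonneg _
  · calc _ ≤ ‖Y (ms i) - X‖⁻¹ * (‖(hσL i).toLp (σ i)‖ * ‖Y (ms i) - X‖) := by gcongr
      _ = _ := by field_simp

end Functional

/-! ### Lipschitz continuous reaction coefficients -/

/-- A reaction coefficient is Lipschitz continuous in each state variable, uniformly in space. -/
structure LipschitzReaction (L M N : ℝ) (f : ℝ → ℝ → ℝ → ℝ) : Prop where
  nonneg_fst : 0 ≤ M
  nonneg_snd : 0 ≤ N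
  measurable : Measurable fun p : ℝ × ℝ × ℝ => f p.1 p.2.1 p.2.2
  memLp_zero : MemLp (fun ξ => f ξ 0 0) 2 (vol L)
  lip : ∀ᵐ ξ ∂(vol L), ∀ s s' t t' : ℝ, |f ξ s t - f ξ s' t'| ≤ M * |s - s'| + N * |t - t'|

theorem ae_vol_neBot {L : ℝ} (hL : 0 < L) : (ae (vol L)).NeBot := by
  rw [ae_neBot, Ne, Measure.restrict_eq_zero, Real.volume_Ioo]
  simpa using hL

theorem SlowReaction.lipschitz {L : ℝ} (hL : 0 < L) {f : ℝ → ℝ → ℝ → ℝ}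
    (hf : SlowReaction L f) : ∃ M, LipschitzReaction L M M f := by
  obtain ⟨M, hM⟩ := hf.bounded
  have hM0 : 0 ≤ M := by
    have := ae_vol_neBot hL
    obtain ⟨ξ, h⟩ := hM.exists
    exact (norm_nonneg _).trans (h 0)
  refine ⟨M, hM0, hM0, hf.measurable, hf.memLp_zero, ?_⟩
  filter_upwards [hf.contDiff, hM] with ξ h1 h2 s s' t t'
  have h := Convex.norm_image_sub_le_of_norm_fderiv_le (𝕜 := ℝ) (s := Set.univ)
    (f := fun σ : ℝ × ℝ => f ξ σ.1 σ.2) (x := (s', t')) (y := (s, t)) (C := M)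
    (fun σ _ => (h1.differentiable (by norm_num)) σ) (fun σ _ => h2 σ) convex_univ
    (Set.mem_univ _) (Set.mem_univ _)
  have hst : ‖((s, t) : ℝ × ℝ) - (s', t')‖ ≤ |s - s'| + |t - t'| := by
    simp only [Prod.norm_def, Prod.mk_sub_mk, Real.norm_eq_abs]
    exact max_le (by linarith [abs_nonneg (t - t')]) (by linarith [abs_nonneg (s - s')])
  have h3 := mul_le_mul_of_nonneg_left hst hM0
  rw [Real.norm_eq_abs] at h
  linarith

/-- The bound on the `σ₁` derivative holds off a null set depending on `σ₂`. Taking rational `σ₂`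
leaves a single null set, and continuity in `σ₂`, valid off a null set common to all `σ`, extends
the Lipschitz bound to real `σ₂`. The constant `N` is `L_g`, so it remains below `lam`. -/
theorem FastReaction.lipschitz {L lam : ℝ} (hL : 0 < L) {g : ℝ → ℝ → ℝ → ℝ}
    (hg : FastReaction L lam g) : ∃ M N, N < lam ∧ LipschitzReaction L M N g := by
  obtain ⟨M, hM⟩ := hg.bounded_fst
  obtain ⟨N, hNl, hN⟩ := hg.dissipative
  have := ae_vol_neBot hL
  have hM0 : 0 ≤ M := by
    obtain ⟨ξ, h⟩ := (hM 0).exists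
    exact (abs_nonneg _).trans (h 0)
  have hN0 : 0 ≤ N := by
    obtain ⟨ξ, h⟩ := hN.exists
    exact (abs_nonneg _).trans (h 0 0).2
  refine ⟨M, N, hNl, hM0, hN0, hg.measurable, hg.memLp_zero, ?_⟩
  filter_upwards [ae_all_iff.2 fun q : ℚ => hg.contDiff_fst q, ae_all_iff.2 fun q : ℚ => hM q, hN]
    with ξ h1 h2 h3
  have hsnd : ∀ s t t', |g ξ s t - g ξ s t'| ≤ N * |t - t'| := fun s t t' =>
    Convex.norm_image_sub_le_of_norm_deriv_le (𝕜 := ℝ) (s := Set.univ) (f := fun r => g ξ s r)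
      (C := N) (fun r _ => (h3 s r).1) (fun r _ => (h3 s r).2) convex_univ
      (Set.mem_univ _) (Set.mem_univ _)
  have hcont : ∀ s, Continuous fun t => g ξ s t := fun s =>
    (show Differentiable ℝ fun t => g ξ s t from fun t => (h3 s t).1).continuous
  have hfst : ∀ s s' t, |g ξ s t - g ξ s' t| ≤ M * |s - s'| := by
    intro s s' t
    have hclosed : IsClosed {t | |g ξ s t - g ξ s' t| ≤ M * |s - s'|} :=
      isClosed_le (((hcont s).sub (hcont s')).abs) continuous_const
    have hden : DenseRange ((↑) : ℚ → ℝ) := Rat.denseRange_cast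
    refine hden.induction_on t hclosed fun q => ?_
    exact Convex.norm_image_sub_le_of_norm_deriv_le (𝕜 := ℝ) (s := Set.univ)
      (f := fun r => g ξ r q) (C := M) (fun r _ => ((h1 q).differentiable (by norm_num)) r)
      (fun r _ => h2 q r) convex_univ (Set.mem_univ _) (Set.mem_univ _)
  intro s s' t t'
  have := abs_sub_le (g ξ s t) (g ξ s' t) (g ξ s' t')
  linarith [hfst s s' t, hsnd s' t t']

/-! ### Nemytskii operators: Lipschitz bounds and derivatives -/

section Nemytskii

variable {L M N : ℝ} {f : ℝ → ℝ → ℝ → ℝ}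

theorem LipschitzReaction.memLp (hf : LipschitzReaction L M N f) (x y : H L) :
    MemLp (fun ξ => f ξ (x ξ) (y ξ)) 2 (vol L) := by
  refine memLp_comp_of_growth hf.measurable hf.memLp_zero M N ?_ x y
  filter_upwards [hf.lip] with ξ h s t
  have := h s 0 t 0
  rw [sub_zero, sub_zero] at this
  linarith [abs_sub_abs_le_abs_sub (f ξ s t) (f ξ 0 0)]

theorem coeFn_toH {φ : ℝ → ℝ} (h : MemLp φ 2 (vol L)) : toH L φ =ᵐ[vol L] φ := by
  rw [toH, dif_pos h]
  exact h.coeFn_toLp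

theorem LipschitzReaction.coeFn_nemytskii (hf : LipschitzReaction L M N f) (x y : H L) :
    nemytskii f x y =ᵐ[vol L] fun ξ => f ξ (x ξ) (y ξ) :=
  coeFn_toH (hf.memLp x y)

theorem LipschitzReaction.norm_nemytskii_sub_le (hf : LipschitzReaction L M N f)
    (x x' y y' : H L) :
    ‖nemytskii f x y - nemytskii f x' y'‖ ≤ M * ‖x - x'‖ + N * ‖y - y'‖ := by
  have h1 : ‖nemytskii f x y - nemytskii f x' y'‖ ≤ ‖M • |x - x'| + N • |y - y'|‖ := by
    refine Lp.norm_le_norm_of_ae_le ?_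
    filter_upwards [hf.lip, hf.coeFn_nemytskii x y, hf.coeFn_nemytskii x' y',
      Lp.coeFn_sub (nemytskii f x y) (nemytskii f x' y'),
      Lp.coeFn_add (M • |x - x'|) (N • |y - y'|), Lp.coeFn_smul M |x - x'|,
      Lp.coeFn_smul N |y - y'|, Lp.coeFn_abs (x - x'), Lp.coeFn_abs (y - y'),
      Lp.coeFn_sub x x', Lp.coeFn_sub y y'] with ξ h0 h1 h2 h3 h4 h5 h6 h7 h8 h9 h10
    rw [h3, h4, Pi.sub_apply, h1, h2, Pi.add_apply, h5, h6, Pi.smul_apply, Pi.smul_apply, h7, h8,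
      h9, h10, Pi.sub_apply, Pi.sub_apply, Real.norm_eq_abs, smul_eq_mul, smul_eq_mul]
    exact (h0 _ _ _ _).trans (le_abs_self _)
  refine h1.trans ((norm_add_le _ _).trans_eq ?_)
  rw [norm_smul, norm_smul, norm_abs_eq_norm, norm_abs_eq_norm, Real.norm_eq_abs, Real.norm_eq_abs,
    abs_of_nonneg hf.nonneg_fst, abs_of_nonneg hf.nonneg_snd]

theorem LipschitzReaction.norm_nemytskii_le (hf : LipschitzReaction L M N f) (x y : H L) :
    ‖nemytskii f x y‖ ≤ ‖nemytskii f (0 : H L) 0‖ + M * ‖x‖ + N * ‖y‖ := by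
  have h := hf.norm_nemytskii_sub_le x 0 y 0
  rw [sub_zero, sub_zero] at h
  linarith [norm_sub_norm_le (nemytskii f x y) (nemytskii f (0 : H L) 0)]

theorem LipschitzReaction.continuous_nemytskii (hf : LipschitzReaction L M N f) :
    Continuous fun p : H L × H L => nemytskii f p.1 p.2 := by
  rw [continuous_iff_continuousAt]
  intro p
  rw [ContinuousAt, tendsto_iff_norm_sub_tendsto_zero]
  refine squeeze_zero (fun _ => norm_nonneg _)
    (fun q => hf.norm_nemytskii_sub_le q.1 p.1 q.2 p.2) ?_
  have : Continuous fun q : H L × H L => M * ‖q.1 - p.1‖ + N * ‖q.2 - p.2‖ := by fun_prop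
  simpa using this.tendsto p

theorem LipschitzReaction.ae_lip_fst (hf : LipschitzReaction L M N f) :
    ∀ᵐ ξ ∂(vol L), ∀ t s s', |f ξ s t - f ξ s' t| ≤ M * |s - s'| := by
  filter_upwards [hf.lip] with ξ h t s s'
  simpa using h s s' t t

theorem measurable_section_fst
    (hf : Measurable fun p : ℝ × ℝ × ℝ => f p.1 p.2.1 p.2.2) (y : H L) :
    Measurable (Function.uncurry fun ξ s => f ξ s (y ξ)) :=
  hf.comp (measurable_fst.prodMk (measurable_snd.prodMk
    ((Lp.stronglyMeasurable y).measurable.comp measurable_fst)))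

theorem LipschitzReaction.memLp_nemytskiiDx (hf : LipschitzReaction L M N f) {x y : H L}
    (hd : ∀ᵐ ξ ∂(vol L), DifferentiableAt ℝ (fun s => f ξ s (y ξ)) (x ξ)) (k : H L) :
    MemLp (fun ξ => deriv (fun s => f ξ s (y ξ)) (x ξ) * k ξ) 2 (vol L) := by
  have hm := aestronglyMeasurable_deriv_comp (measurable_section_fst hf.measurable y)
    (Lp.aestronglyMeasurable x).aemeasurable hd
  refine ((Lp.memLp k).abs.const_mul M).mono' (hm.mul (Lp.aestronglyMeasurable k)) ?_
  filter_upwards [hf.ae_lip_fst] with ξ h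
  rw [Real.norm_eq_abs, abs_mul]
  exact mul_le_mul_of_nonneg_right (abs_deriv_le_of_lip hf.nonneg_fst (h _) _) (abs_nonneg _)

/-- Gâteaux differentiability of Nemytskii operators. -/
theorem LipschitzReaction.hasLineDerivAt_nemytskii (hf : LipschitzReaction L M N f) {x y : H L}
    (hd : ∀ᵐ ξ ∂(vol L), DifferentiableAt ℝ (fun s => f ξ s (y ξ)) (x ξ)) (k : H L) :
    HasLineDerivAt ℝ (fun x' => nemytskii f x' y) (nemytskiiDx f x y k) x k := by
  rw [hasLineDerivAt_iff_tendsto_slope_zero]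
  refine tendsto_of_seq_tendsto fun t ht => ?_
  have ht0 := tendsto_nhdsWithin_iff.1 ht
  rw [tendsto_iff_norm_sub_tendsto_zero]
  set D := nemytskiiDx f x y k
  set Q : ℕ → H L := fun n => (t n)⁻¹ • (nemytskii f (x + t n • k) y - nemytskii f x y) - D
  have hQ : ∀ n, Q n =ᵐ[vol L] fun ξ => (t n)⁻¹ *
      (f ξ (x ξ + t n * k ξ) (y ξ) - f ξ (x ξ) (y ξ)) -
        deriv (fun s => f ξ s (y ξ)) (x ξ) * k ξ := by
    intro n
    filter_upwards [Lp.coeFn_sub ((t n)⁻¹ • (nemytskii f (x + t n • k) y - nemytskii f x y)) D,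
      Lp.coeFn_smul (t n)⁻¹ (nemytskii f (x + t n • k) y - nemytskii f x y),
      Lp.coeFn_sub (nemytskii f (x + t n • k) y) (nemytskii f x y),
      hf.coeFn_nemytskii (x + t n • k) y, hf.coeFn_nemytskii x y,
      coeFn_toH (hf.memLp_nemytskiiDx hd k), Lp.coeFn_add x (t n • k), Lp.coeFn_smul (t n) k]
      with ξ h1 h2 h3 h4 h5 h6 h7 h8
    rw [h1, Pi.sub_apply, h2, Pi.smul_apply, h3, Pi.sub_apply, h4, h5, h7, Pi.add_apply, h8,
      Pi.smul_apply, smul_eq_mul, smul_eq_mul]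
    exact congrArg _ h6
  have hlim := tendsto_norm_toLp_zero (μ := vol L) (φ := fun n => Q n) (fun n => Lp.memLp (Q n))
    (b := fun ξ => 2 * (M * |k ξ|)) (((Lp.memLp k).abs.const_mul M).const_mul 2)
    (fun n => by
      filter_upwards [hQ n, hf.ae_lip_fst] with ξ h1 h2
      rw [h1]
      have e1 := mul_le_mul_of_nonneg_right
        (abs_deriv_le_of_lip hf.nonneg_fst (h2 (y ξ)) (x ξ)) (abs_nonneg (k ξ))
      have e2 := h2 (y ξ) (x ξ + t n * k ξ) (x ξ)
      rw [add_sub_cancel_left, abs_mul] at e2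
      have e3 : |(t n)⁻¹ * (f ξ (x ξ + t n * k ξ) (y ξ) - f ξ (x ξ) (y ξ))| ≤ M * |k ξ| := by
        rw [abs_mul, abs_inv]
        -- The sequence avoids `0` only eventually, while the domination is required for every `n`;
        -- at `t n = 0` the convention `0⁻¹ = 0` removes the quotient.
        rcases eq_or_ne (t n) 0 with h0 | h0
        · rw [h0]
          simpa using mul_nonneg hf.nonneg_fst (abs_nonneg _)
        · rw [inv_mul_le_iff₀ (abs_pos.2 h0)]
          linarith
      refine (abs_sub _ _).trans ?_
      rw [abs_mul (deriv _ _)]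
      linarith)
    (by
      filter_upwards [ae_all_iff.2 hQ, hd] with ξ h1 h2
      simp only [h1]
      have h3 : HasDerivAt (fun r : ℝ => f ξ (x ξ + r * k ξ) (y ξ))
          (deriv (fun s => f ξ s (y ξ)) (x ξ) * k ξ) 0 := by
        have h4 : HasDerivAt (fun r : ℝ => x ξ + r * k ξ) (k ξ) 0 := by
          simpa using ((hasDerivAt_id (0 : ℝ)).mul_const (k ξ)).const_add (x ξ)
        have h5 : HasDerivAt (fun s => f ξ s (y ξ)) (deriv (fun s => f ξ s (y ξ)) (x ξ))
            (x ξ + 0 * k ξ) := by simpa using h2.hasDerivAt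
        exact h5.comp 0 h4
      have h6 := (hasDerivAt_iff_tendsto_slope_zero.1 h3).comp ht
      have h7 := h6.sub_const (deriv (fun s => f ξ s (y ξ)) (x ξ) * k ξ)
      simpa [Function.comp_def] using h7)
  simpa [Lp.toLp_coeFn] using hlim

/-- Pairing with a fixed `h` gives an integrand with Lipschitz constant `M|h|` in `L²`, which
upgrades Gâteaux to Fréchet differentiability. -/
theorem LipschitzReaction.differentiableAt_inner_nemytskii (hf : LipschitzReaction L M N f)
    {x y : H L} (hd : ∀ᵐ ξ ∂(vol L), DifferentiableAt ℝ (fun s => f ξ s (y ξ)) (x ξ))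
    (h : H L) : DifferentiableAt ℝ (fun x' => inner ℝ (nemytskii f x' y) h) x := by
  have hm := measurable_section_fst hf.measurable y
  have hh : Measurable h := (Lp.stronglyMeasurable h).measurable
  have key := differentiableAt_integral_comp (μ := vol L)
    (φ := fun ξ s => f ξ s (y ξ) * h ξ) (b := fun ξ => M * |h ξ|)
    (hm.mul (hh.comp measurable_fst)) ((Lp.memLp h).abs.const_mul M)
    (by
      filter_upwards [hf.ae_lip_fst] with ξ h1 s t
      rw [← sub_mul, abs_mul]
      have := mul_le_mul_of_nonneg_right (h1 (y ξ) s t) (abs_nonneg (h ξ))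
      linarith)
    (by
      refine MemLp.integrable_mul (p := 2) (q := 2) ?_ (Lp.memLp h)
      refine (hf.memLp 0 y).ae_eq ?_
      filter_upwards [Lp.coeFn_zero ℝ 2 (vol L)] with ξ h0
      rw [h0, Pi.zero_apply]) x
    (hd.mono fun ξ h1 => h1.mul_const _)
  refine key.congr_of_eventuallyEq (Eventually.of_forall fun x' => ?_)
  simp only
  rw [inner_H]
  refine integral_congr_ae ?_
  filter_upwards [hf.coeFn_nemytskii x' y] with ξ h1
  rw [h1]

/-- A Fréchet derivative is determined by its line derivatives, and those are known from the Gâteaux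
derivative. -/
theorem LipschitzReaction.fderiv_inner_nemytskii (hf : LipschitzReaction L M N f)
    {x y : H L} (hd : ∀ᵐ ξ ∂(vol L), DifferentiableAt ℝ (fun s => f ξ s (y ξ)) (x ξ))
    (h k : H L) : fderiv ℝ (fun x' => inner ℝ (nemytskii f x' y) h) x k =
      inner ℝ (nemytskiiDx f x y k) h := by
  have h1 := (hf.differentiableAt_inner_nemytskii hd h).hasFDerivAt.hasLineDerivAt k
  have h2 : HasLineDerivAt ℝ (fun x' => inner ℝ (nemytskii f x' y) h)
      (inner ℝ (nemytskiiDx f x y k) h) x k := by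
    have h3 : HasDerivAt (fun t : ℝ => nemytskii f (x + t • k) y) (nemytskiiDx f x y k) 0 :=
      hf.hasLineDerivAt_nemytskii hd k
    have h4 := h3.inner ℝ (hasDerivAt_const (0 : ℝ) h)
    simpa [HasLineDerivAt] using h4
  exact h1.lineDeriv.symm.trans h2.lineDeriv

end Nemytskii

/-! ### The potential -/

section Potential

variable {L M N : ℝ} {g : ℝ → ℝ → ℝ → ℝ}

theorem LipschitzReaction.continuous_inner_nemytskii_smul (hg : LipschitzReaction L M N g) :
    Continuous fun p : (H L × H L) × ℝ => inner ℝ (nemytskii g p.1.1 (p.2 • p.1.2)) p.1.2 := by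
  have := hg.continuous_nemytskii.comp (by fun_prop :
    Continuous fun p : (H L × H L) × ℝ => (p.1.1, p.2 • p.1.2))
  exact this.inner (by fun_prop)

theorem LipschitzReaction.continuous_potential (hg : LipschitzReaction L M N g) :
    Continuous fun p : H L × H L => potential g p.1 p.2 :=
  intervalIntegral.continuous_parametric_intervalIntegral_of_continuous'
    (f := fun (p : H L × H L) (θ : ℝ) => inner ℝ (nemytskii g p.1 (θ • p.2)) p.2)
    hg.continuous_inner_nemytskii_smul 0 1

theorem LipschitzReaction.intervalIntegrable_inner (hg : LipschitzReaction L M N g) (x y : H L) :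
    IntervalIntegrable (fun θ : ℝ => inner ℝ (nemytskii g x (θ • y)) y) volume 0 1 :=
  (hg.continuous_inner_nemytskii_smul.comp
    (by fun_prop : Continuous fun θ : ℝ => ((x, y), θ))).intervalIntegrable 0 1

/-- The factor `1/2` is `∫₀¹ θ dθ`. It is essential: it makes `2U` grow like `N‖y‖²`, which is
compared with the Gaussian threshold `lam`. -/
theorem LipschitzReaction.abs_potential_le (hg : LipschitzReaction L M N g) (x y : H L) :
    |potential g x y| ≤ (‖nemytskii g (0 : H L) 0‖ + M * ‖x‖) * ‖y‖ + N / 2 * ‖y‖ ^ 2 := by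
  set C := ‖nemytskii g (0 : H L) 0‖ + M * ‖x‖ with hC
  have h1 : ‖potential g x y‖ ≤ ∫ θ in (0 : ℝ)..1, (C * ‖y‖ + N * ‖y‖ ^ 2 * θ) := by
    refine intervalIntegral.norm_integral_le_of_norm_le zero_le_one ?_
      (Continuous.intervalIntegrable (by fun_prop) 0 1)
    refine Eventually.of_forall fun θ hθ => ?_
    refine (norm_inner_le_norm _ _).trans ?_
    have h2 := hg.norm_nemytskii_le x (θ • y)
    rw [norm_smul, Real.norm_eq_abs, abs_of_pos hθ.1] at h2
    have := mul_le_mul_of_nonneg_right h2 (norm_nonneg y)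
    refine this.trans_eq ?_
    rw [hC]; ring
  refine h1.trans_eq ?_
  rw [intervalIntegral.integral_add intervalIntegrable_const
      (Continuous.intervalIntegrable (by fun_prop) 0 1), intervalIntegral.integral_const,
    intervalIntegral.integral_const_mul, integral_id, smul_eq_mul]
  ring

theorem LipschitzReaction.abs_potential_sub_le (hg : LipschitzReaction L M N g) (x x' y : H L) :
    |potential g x y - potential g x' y| ≤ M * ‖y‖ * ‖x - x'‖ := by
  rw [potential, potential, ← intervalIntegral.integral_sub (hg.intervalIntegrable_inner x y)
    (hg.intervalIntegrable_inner x' y)]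
  have := intervalIntegral.norm_integral_le_of_norm_le_const (a := (0 : ℝ)) (b := 1)
    (f := fun θ : ℝ => inner ℝ (nemytskii g x (θ • y)) y - inner ℝ (nemytskii g x' (θ • y)) y)
    (C := M * ‖y‖ * ‖x - x'‖) fun θ _ => by
      rw [← inner_sub_left]
      refine (norm_inner_le_norm _ _).trans ?_
      have h := hg.norm_nemytskii_sub_le x x' (θ • y) (θ • y)
      rw [sub_self, norm_zero, mul_zero, add_zero] at h
      have := mul_le_mul_of_nonneg_right h (norm_nonneg y)
      linarith
  simpa using this

/-- Near `0`, a punctured open set lies in the closure of its rational points, and closed balls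
contain the limits of values along them. -/
theorem tendsto_of_tendsto_rat {q : ℝ → ℝ} (hq : ContinuousOn q {0}ᶜ) {c : ℝ}
    (h : Tendsto (fun r : ℚ => q r) (comap ((↑) : ℚ → ℝ) (𝓝[≠] 0)) (𝓝 c)) :
    Tendsto q (𝓝[≠] 0) (𝓝 c) := by
  rw [Metric.nhds_basis_closedBall.tendsto_right_iff] at h ⊢
  intro ε hε
  have h1 := eventually_comap.1 (h ε hε)
  obtain ⟨u, hu, h0u, hus⟩ := eventually_nhds_iff.1 (eventually_nhdsWithin_iff.1 h1)
  rw [eventually_nhdsWithin_iff]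
  filter_upwards [h0u.mem_nhds hus] with t ht ht0
  have hopen : IsOpen (u ∩ {0}ᶜ) := h0u.inter isOpen_compl_singleton
  have hden : Dense (Set.range ((↑) : ℚ → ℝ)) := Rat.denseRange_cast
  have hcl := hden.open_subset_closure_inter hopen ⟨ht, ht0⟩
  have hcw : ContinuousWithinAt q ((u ∩ {0}ᶜ) ∩ Set.range ((↑) : ℚ → ℝ)) t :=
    ((hq t ht0).continuousAt (isOpen_compl_singleton.mem_nhds ht0)).continuousWithinAt
  have := hcw.mem_closure hcl (t := Metric.closedBall c ε) (by
    rintro _ ⟨⟨hs, hs0⟩, r, rfl⟩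
    exact hu _ hs hs0 r rfl)
  rwa [Metric.isClosed_closedBall.closure_eq] at this

/-- For a continuous function of a real variable, differentiability is seen by rational
increments. -/
theorem differentiableAt_iff_rat {φ : ℝ → ℝ} (hφ : Continuous φ) (s : ℝ) :
    DifferentiableAt ℝ φ s ↔ ∃ c, Tendsto (fun r : ℚ => (r : ℝ)⁻¹ * (φ (s + r) - φ s))
      (comap ((↑) : ℚ → ℝ) (𝓝[≠] 0)) (𝓝 c) := by
  constructor
  · intro h
    exact ⟨deriv φ s, (hasDerivAt_iff_tendsto_slope_zero.1 h.hasDerivAt).comp tendsto_comap⟩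
  · rintro ⟨c, hc⟩
    refine HasDerivAt.differentiableAt (f' := c) (hasDerivAt_iff_tendsto_slope_zero.2 ?_)
    refine tendsto_of_tendsto_rat (q := fun t => t⁻¹ • (φ (s + t) - φ s)) ?_ hc
    exact (continuousOn_inv₀).smul (by fun_prop)

/-- For each `s`, differentiability of `g(ξ, ·, s)` holds for almost every `ξ`; by Fubini, for
almost every `ξ` it holds for almost every `s`. If `y(ξ) ≠ 0`, the map `θ ↦ θ y(ξ)` pulls null sets
back to null sets, and if `y(ξ) = 0` the integrand is zero. -/
theorem FastReaction.ae_ae_differentiableAt {lam : ℝ} (hg : FastReaction L lam g)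
    (hlip : LipschitzReaction L M N g) (x y : H L) :
    ∀ᵐ p : ℝ × ℝ ∂((volume.restrict (Set.Ioc 0 1)).prod (vol L)),
      DifferentiableAt ℝ (fun s => g p.2 s (p.1 * y p.2) * y p.2) (x p.2) := by
  have hx : Measurable x := (Lp.stronglyMeasurable x).measurable
  have hy : Measurable y := (Lp.stronglyMeasurable y).measurable
  -- Fubini requires a measurable set. Existence of a limit over the countably many rational
  -- increments is a measurable condition, and for continuous functions it is equivalent to
  -- differentiability.
  set E : Set (ℝ × ℝ) := {p | ∃ c, Tendsto (fun r : ℚ => (r : ℝ)⁻¹ *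
    (g p.1 (x p.1 + r) p.2 - g p.1 (x p.1) p.2)) (comap ((↑) : ℚ → ℝ) (𝓝[≠] 0)) (𝓝 c)} with hE
  have hEm : MeasurableSet E := by
    refine measurableSet_exists_tendsto fun r => Measurable.const_mul (Measurable.sub ?_ ?_) _
    · exact hg.measurable.comp (measurable_fst.prodMk
        (((hx.comp measurable_fst).add_const _).prodMk measurable_snd))
    · exact hg.measurable.comp (measurable_fst.prodMk
        ((hx.comp measurable_fst).prodMk measurable_snd))
  have h1 : ∀ᵐ s ∂(volume : Measure ℝ), ∀ᵐ ξ ∂(vol L), (ξ, s) ∈ E := by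
    refine Eventually.of_forall fun s => ?_
    filter_upwards [hg.contDiff_fst s] with ξ h
    exact (differentiableAt_iff_rat h.continuous (x ξ)).1
      ((h.differentiable (by norm_num)) (x ξ))
  have h2 : ∀ᵐ ξ ∂(vol L), ∀ᵐ s ∂(volume : Measure ℝ), (ξ, s) ∈ E :=
    (Measure.ae_ae_comm (p := fun ξ s => (ξ, s) ∈ E) hEm).2 h1
  set E' : Set (ℝ × ℝ) := {p | y p.2 = 0 ∨ (p.2, p.1 * y p.2) ∈ E} with hE'
  have hEm' : MeasurableSet E' := by
    refine MeasurableSet.union ?_ ?_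
    · exact (hy.comp measurable_snd) (measurableSet_singleton 0)
    · exact (measurable_snd.prodMk (measurable_fst.mul (hy.comp measurable_snd))) hEm
  have h3 : ∀ᵐ ξ ∂(vol L), ∀ᵐ θ ∂(volume.restrict (Set.Ioc (0 : ℝ) 1)), (θ, ξ) ∈ E' := by
    filter_upwards [h2] with ξ h
    rcases eq_or_ne (y ξ) 0 with h0 | h0
    · exact Eventually.of_forall fun θ => Or.inl h0
    · refine ae_restrict_of_ae ?_
      filter_upwards [(Measure.quasiMeasurePreserving_smul (volume : Measure ℝ) h0).ae h] with θ hθ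
      refine Or.inr ?_
      rwa [smul_eq_mul, mul_comm] at hθ
  have h4 : ∀ᵐ p : ℝ × ℝ ∂((volume.restrict (Set.Ioc 0 1)).prod (vol L)), p ∈ E' :=
    (Measure.ae_prod_iff_ae_ae (p := fun p : ℝ × ℝ => p ∈ E') hEm').2
      ((Measure.ae_ae_comm (p := fun θ ξ => (θ, ξ) ∈ E') hEm').2 h3)
  have h5 : ∀ᵐ p : ℝ × ℝ ∂((volume.restrict (Set.Ioc 0 1)).prod (vol L)),
      ∀ t s s', |g p.2 s t - g p.2 s' t| ≤ M * |s - s'| :=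
    Measure.quasiMeasurePreserving_snd.ae hlip.ae_lip_fst
  filter_upwards [h4, h5] with p hp hl
  rcases hp with h0 | hp
  · simp [h0]
  · have hc : Continuous fun s => g p.2 s (p.1 * y p.2) :=
      (LipschitzWith.of_dist_le_mul (K := ⟨M, hlip.nonneg_fst⟩) fun s s' => hl _ s s').continuous
    have : DifferentiableAt ℝ (fun s => g p.2 s (p.1 * y p.2)) (x p.2) :=
      (differentiableAt_iff_rat hc _).2 hp
    exact this.mul_const _

theorem LipschitzReaction.integrable_prod (hg : LipschitzReaction L M N g) (x y : H L) :
    Integrable (fun p : ℝ × ℝ => g p.2 (x p.2) (p.1 * y p.2) * y p.2)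
      ((volume.restrict (Set.Ioc 0 1)).prod (vol L)) := by
  have hx : Measurable x := (Lp.stronglyMeasurable x).measurable
  have hy : Measurable y := (Lp.stronglyMeasurable y).measurable
  have hm : Measurable fun p : ℝ × ℝ => g p.2 (x p.2) (p.1 * y p.2) * y p.2 :=
    (hg.measurable.comp (measurable_snd.prodMk ((hx.comp measurable_snd).prodMk
      (measurable_fst.mul (hy.comp measurable_snd))))).mul (hy.comp measurable_snd)
  have hb : Integrable (fun ξ => (|g ξ 0 0| + M * |x ξ| + N * |y ξ|) * |y ξ|) (vol L) :=
    MemLp.integrable_mul (p := 2) (q := 2) ((hg.memLp_zero.abs.add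
      ((Lp.memLp x).abs.const_mul M)).add ((Lp.memLp y).abs.const_mul N)) (Lp.memLp y).abs
  have hfst : ∀ᵐ p : ℝ × ℝ ∂((volume.restrict (Set.Ioc 0 1)).prod (vol L)), p.1 ∈ Set.Ioc 0 1 :=
    Measure.quasiMeasurePreserving_fst.ae (ae_restrict_mem measurableSet_Ioc)
  have hlip : ∀ᵐ p : ℝ × ℝ ∂((volume.restrict (Set.Ioc 0 1)).prod (vol L)),
      ∀ s s' t t' : ℝ, |g p.2 s t - g p.2 s' t'| ≤ M * |s - s'| + N * |t - t'| :=
    Measure.quasiMeasurePreserving_snd.ae hg.lip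
  refine (hb.comp_snd (volume.restrict (Set.Ioc (0 : ℝ) 1))).mono' hm.aestronglyMeasurable ?_
  filter_upwards [hfst, hlip] with p h1 h2
  rw [Real.norm_eq_abs, abs_mul]
  refine mul_le_mul_of_nonneg_right ?_ (abs_nonneg _)
  have h3 := h2 (x p.2) 0 (p.1 * y p.2) 0
  rw [sub_zero, sub_zero, abs_mul, abs_of_pos h1.1] at h3
  have h4 : p.1 * |y p.2| ≤ |y p.2| := mul_le_of_le_one_left (abs_nonneg _) h1.2
  have h5 := mul_le_mul_of_nonneg_left h4 hg.nonneg_snd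
  linarith [abs_sub_abs_le_abs_sub (g p.2 (x p.2) (p.1 * y p.2)) (g p.2 0 0)]

theorem LipschitzReaction.potential_eq_integral_prod (hg : LipschitzReaction L M N g)
    (x y : H L) : potential g x y =
      ∫ p : ℝ × ℝ, g p.2 (x p.2) (p.1 * y p.2) * y p.2
        ∂((volume.restrict (Set.Ioc 0 1)).prod (vol L)) := by
  rw [integral_prod _ (hg.integrable_prod x y), potential, intervalIntegral.integral_of_le zero_le_one]
  refine integral_congr_ae (Eventually.of_forall fun θ => ?_)
  simp only
  rw [inner_H]
  refine integral_congr_ae ?_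
  filter_upwards [hg.coeFn_nemytskii x (θ • y), Lp.coeFn_smul θ y] with ξ h1 h2
  rw [h1, h2, Pi.smul_apply, smul_eq_mul]

/-- Fréchet differentiability of the potential in the slow variable. -/
theorem FastReaction.differentiableAt_potential {lam : ℝ} (hg : FastReaction L lam g)
    (hlip : LipschitzReaction L M N g) (x y : H L) :
    DifferentiableAt ℝ (fun x' => potential g x' y) x := by
  have : IsProbabilityMeasure (volume.restrict (Set.Ioc (0 : ℝ) 1)) := ⟨by simp⟩
  set P := (volume.restrict (Set.Ioc (0 : ℝ) 1)).prod (vol L) with hP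
  have hmp : MeasurePreserving Prod.snd P (vol L) := measurePreserving_snd
  have hy : Measurable y := (Lp.stronglyMeasurable y).measurable
  -- The isometry `z ↦ z ∘ snd` from `H` into `L²` of the product: `U(·, y)` is an integral
  -- functional on the larger space composed with it, and the chain rule applies.
  set T := (Lp.compMeasurePreservingₗᵢ ℝ (E := ℝ) (p := 2) Prod.snd hmp).toContinuousLinearMap
  have hT : ∀ z : H L, T z =ᵐ[P] fun p => z p.2 := fun z => Lp.coeFn_compMeasurePreserving z hmp
  have hb : MemLp (fun ξ => M * |y ξ|) 2 (vol L) := (Lp.memLp y).abs.const_mul M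
  have hzero : Integrable (fun p : ℝ × ℝ => g p.2 0 (p.1 * y p.2) * y p.2) P := by
    refine (hlip.integrable_prod 0 y).congr ?_
    filter_upwards [Measure.quasiMeasurePreserving_snd.ae (Lp.coeFn_zero ℝ 2 (vol L))] with p h
    rw [h, Pi.zero_apply]
  have key := differentiableAt_integral_comp (μ := P)
    (φ := fun p s => g p.2 s (p.1 * y p.2) * y p.2) (b := fun p => M * |y p.2|)
    ((hg.measurable.comp ((measurable_snd.comp measurable_fst).prodMk (measurable_snd.prodMk
      ((measurable_fst.comp measurable_fst).mul (hy.comp (measurable_snd.comp measurable_fst)))))).mul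
      (hy.comp (measurable_snd.comp measurable_fst)))
    (hb.comp_measurePreserving hmp)
    (by
      filter_upwards [Measure.quasiMeasurePreserving_snd.ae hlip.ae_lip_fst] with p h s t
      rw [← sub_mul, abs_mul]
      have := mul_le_mul_of_nonneg_right (h (p.1 * y p.2) s t) (abs_nonneg (y p.2))
      linarith)
    hzero (T x)
    (by
      filter_upwards [hg.ae_ae_differentiableAt hlip x y, hT x] with p h1 h2
      rwa [h2])
  have hcomp := key.comp x T.differentiableAt
  refine hcomp.congr_of_eventuallyEq (Eventually.of_forall fun x' => ?_)
  simp only [Function.comp_apply]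
  rw [hlip.potential_eq_integral_prod]
  refine integral_congr_ae ?_
  filter_upwards [hT x'] with p h
  rw [h]

end Potential

/-! ### Differentiation under the Gaussian integral -/

section Weighted

variable {L : ℝ}

theorem measurable_fderiv_apply {Ψ : H L → H L → ℝ} {x : H L} (hm : ∀ x', Measurable (Ψ x'))
    (hd : ∀ y, DifferentiableAt ℝ (fun x' => Ψ x' y) x) (k : H L) :
    Measurable fun y => fderiv ℝ (fun x' => Ψ x' y) x k := by
  have hs : Tendsto (fun n : ℕ => 1 / ((n : ℝ) + 1)) atTop (𝓝[≠] 0) :=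
    tendsto_nhdsWithin_iff.2 ⟨tendsto_one_div_add_atTop_nhds_zero_nat,
      Eventually.of_forall fun n => by
        simp only [Set.mem_compl_iff, Set.mem_singleton_iff]; positivity⟩
  refine measurable_of_tendsto_metrizable (f := fun (n : ℕ) y => (1 / ((n : ℝ) + 1))⁻¹ *
    (Ψ (x + (1 / ((n : ℝ) + 1)) • k) y - Ψ x y)) (fun n => ?_) (tendsto_pi_nhds.2 fun y => ?_)
  · exact ((hm _).sub (hm _)).const_mul _
  · exact (hasLineDerivAt_iff_tendsto_slope_zero.1
      ((hd y).hasFDerivAt.hasLineDerivAt k)).comp hs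

/-- By Riesz the derivative is a vector of `H`, the limit of its expansions in the basis `e`, whose
coefficients are measurable as limits of difference quotients. -/
theorem stronglyMeasurable_fderiv (e : HilbertBasis ℕ ℝ (H L)) {Ψ : H L → H L → ℝ} {x : H L}
    (hm : ∀ x', Measurable (Ψ x')) (hd : ∀ y, DifferentiableAt ℝ (fun x' => Ψ x' y) x) :
    StronglyMeasurable fun y => fderiv ℝ (fun x' => Ψ x' y) x := by
  set v : H L → H L := fun y =>
    (InnerProductSpace.toDual ℝ (H L)).symm (fderiv ℝ (fun x' => Ψ x' y) x) with hv
  have hvm : StronglyMeasurable v := by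
    refine stronglyMeasurable_of_tendsto atTop (f := fun (n : ℕ) y =>
      ∑ k ∈ Finset.range n, (fderiv ℝ (fun x' => Ψ x' y) x (e k)) • e k) (fun n => ?_)
      (tendsto_pi_nhds.2 fun y => ?_)
    · exact Finset.stronglyMeasurable_fun_sum _ fun k _ =>
        (measurable_fderiv_apply hm hd (e k)).stronglyMeasurable.smul_const _
    · refine ((e.hasSum_repr (v y)).tendsto_sum_nat).congr fun n => ?_
      refine Finset.sum_congr rfl fun k _ => ?_
      rw [e.repr_apply_apply, real_inner_comm, hv, InnerProductSpace.toDual_symm_apply]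
  have := (InnerProductSpace.toDual ℝ (H L)).continuous.comp_stronglyMeasurable hvm
  simpa [hv] using this

/-- Tangent lines of the convex exponential, at both end points. -/
theorem abs_exp_sub_exp_le {a b E : ℝ} (ha : Real.exp a ≤ E) (hb : Real.exp b ≤ E) :
    |Real.exp a - Real.exp b| ≤ E * |a - b| := by
  have key : ∀ a b : ℝ, Real.exp a - Real.exp b ≤ Real.exp a * (a - b) := by
    intro a b
    have h1 := Real.add_one_le_exp (b - a)
    have h2 := mul_le_mul_of_nonneg_left h1 (Real.exp_pos a).le
    rw [← Real.exp_add, add_sub_cancel] at h2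
    linarith
  have h1 := mul_le_mul_of_nonneg_left (le_abs_self (a - b)) (Real.exp_pos a).le
  have h2 := mul_le_mul_of_nonneg_left (neg_abs_le (a - b)) (Real.exp_pos b).le
  have h3 := mul_le_mul_of_nonneg_right ha (abs_nonneg (a - b))
  have h4 := mul_le_mul_of_nonneg_right hb (abs_nonneg (a - b))
  rw [abs_le]
  constructor <;> linarith [key a b, key b a]

variable {γ : Measure (H L)} {c A M N : ℝ} {U : H L → H L → ℝ}

/-- Completing the square, `a r ≤ a² / (4(c - N)) + (c - N) r²`: the gap between `N` and `c` absorbs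
any linear term. -/
theorem integrable_exp_quadratic (hexp : Integrable (fun y : H L => Real.exp (c * ‖y‖ ^ 2)) γ)
    (hN : N < c) (a : ℝ) :
    Integrable (fun y : H L => Real.exp (a * ‖y‖ + N * ‖y‖ ^ 2)) γ := by
  have hc : Continuous fun y : H L => Real.exp (a * ‖y‖ + N * ‖y‖ ^ 2) := by fun_prop
  refine (hexp.const_mul (Real.exp (a ^ 2 / (4 * (c - N))))).mono' hc.aestronglyMeasurable
    (Eventually.of_forall fun y => ?_)
  rw [Real.norm_eq_abs, Real.abs_exp, ← Real.exp_add, Real.exp_le_exp]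
  have hp : 0 < c - N := sub_pos.2 hN
  have h1 : a ^ 2 / (4 * (c - N)) = (a / (2 * (c - N))) ^ 2 * (c - N) := by field_simp; norm_num
  have h2 : a * ‖y‖ = 2 * (a / (2 * (c - N))) * ‖y‖ * (c - N) := by field_simp
  rw [h1, h2]
  nlinarith [mul_nonneg (sq_nonneg (a / (2 * (c - N)) - ‖y‖)) hp.le]

/-- Growth and Lipschitz conditions on a potential. -/
structure PotentialBound (A M N : ℝ) (U : H L → H L → ℝ) : Prop where
  nonneg_A : 0 ≤ A
  nonneg_M : 0 ≤ M
  continuous : ∀ x, Continuous (U x)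
  bound : ∀ x y, |U x y| ≤ (A + M * ‖x‖) * ‖y‖ + N / 2 * ‖y‖ ^ 2
  lip : ∀ x x' y, |U x y - U x' y| ≤ M * ‖y‖ * ‖x - x'‖
  differentiable : ∀ x y, DifferentiableAt ℝ (fun x' => U x' y) x

theorem PotentialBound.exp_le (hU : PotentialBound A M N U) {R : ℝ} {x : H L} (hx : ‖x‖ ≤ R)
    (y : H L) : Real.exp (2 * U x y) ≤ Real.exp (2 * (A + M * R) * ‖y‖ + N * ‖y‖ ^ 2) := by
  rw [Real.exp_le_exp]
  have h1 := mul_le_mul_of_nonneg_right (mul_le_mul_of_nonneg_left hx hU.nonneg_M) (norm_nonneg y)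
  have h2 := (le_abs_self _).trans (hU.bound x y)
  linarith

/-- Exponential growth of `q` only changes the linear term of the exponent. -/
theorem PotentialBound.integrable_exp_smul (hU : PotentialBound A M N U)
    (hexp : Integrable (fun y : H L => Real.exp (c * ‖y‖ ^ 2)) γ) (hN : N < c)
    {E : Type*} [NormedAddCommGroup E] [NormedSpace ℝ E] {q : H L → E}
    (hq : AEStronglyMeasurable q γ) {C b : ℝ} (hb : ∀ y, ‖q y‖ ≤ C * Real.exp (b * ‖y‖))
    (x : H L) : Integrable (fun y => Real.exp (2 * U x y) • q y) γ := by
  have hcont : Continuous fun y => Real.exp (2 * U x y) :=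
    Real.continuous_exp.comp ((hU.continuous x).const_mul 2)
  refine ((integrable_exp_quadratic hexp hN (2 * (A + M * ‖x‖) + b)).const_mul C).mono'
    (hcont.aestronglyMeasurable.smul hq) (Eventually.of_forall fun y => ?_)
  rw [norm_smul, Real.norm_eq_abs, Real.abs_exp]
  refine (mul_le_mul (hU.exp_le le_rfl y) (hb y) (norm_nonneg _) (Real.exp_pos _).le).trans_eq ?_
  rw [mul_left_comm, ← Real.exp_add]
  congr 2
  ring

theorem PotentialBound.integrable_exp (hU : PotentialBound A M N U)
    (hexp : Integrable (fun y : H L => Real.exp (c * ‖y‖ ^ 2)) γ) (hN : N < c) (x : H L)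
    [IsFiniteMeasure γ] : Integrable (fun y => Real.exp (2 * U x y)) γ := by
  have := hU.integrable_exp_smul hexp hN (q := fun _ => (1 : ℝ)) aestronglyMeasurable_const
    (C := 1) (b := 0) (fun y => by simp) x
  simpa using this

theorem PotentialBound.norm_fderiv_le (hU : PotentialBound A M N U) (x y k : H L) :
    ‖fderiv ℝ (fun x' => U x' y) x k‖ ≤ M * ‖y‖ * ‖k‖ := by
  have h0 : 0 ≤ M * ‖y‖ := mul_nonneg hU.nonneg_M (norm_nonneg y)
  have hl : LipschitzWith ⟨M * ‖y‖, h0⟩ fun x' => U x' y :=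
    LipschitzWith.of_dist_le_mul fun a b => by
      rw [Real.dist_eq, dist_eq_norm]; exact hU.lip a b y
  have := norm_fderiv_le_of_lipschitz ℝ hl (x₀ := x)
  exact ((fderiv ℝ (fun x' => U x' y) x).le_opNorm k).trans
    (mul_le_mul_of_nonneg_right this (norm_nonneg k))

/-- Growth and Lipschitz conditions on an observable. -/
structure ObservableBound (C K : ℝ) (Φ : H L → H L → ℝ) : Prop where
  nonneg_C : 0 ≤ C
  nonneg_K : 0 ≤ K
  continuous : ∀ x, Continuous (Φ x)
  bound : ∀ x y, |Φ x y| ≤ C * (1 + ‖x‖ + ‖y‖)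
  lip : ∀ x x' y, |Φ x y - Φ x' y| ≤ K * ‖x - x'‖
  differentiable : ∀ x y, DifferentiableAt ℝ (fun x' => Φ x' y) x

variable {C K : ℝ} {Φ : H L → H L → ℝ}

theorem ObservableBound.le_exp (hΦ : ObservableBound C K Φ) {R : ℝ} {x : H L} (hx : ‖x‖ ≤ R)
    (y : H L) : |Φ x y| ≤ C * (1 + R) * Real.exp ‖y‖ := by
  have h1 := Real.add_one_le_exp ‖y‖
  have h2 : 0 ≤ ‖x‖ := norm_nonneg x
  refine (hΦ.bound x y).trans ?_
  rw [mul_assoc]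
  refine mul_le_mul_of_nonneg_left ?_ hΦ.nonneg_C
  nlinarith [norm_nonneg y]

theorem ObservableBound.norm_fderiv_le (hΦ : ObservableBound C K Φ) (x y k : H L) :
    ‖fderiv ℝ (fun x' => Φ x' y) x k‖ ≤ K * ‖k‖ := by
  have hl : LipschitzWith ⟨K, hΦ.nonneg_K⟩ fun x' => Φ x' y :=
    LipschitzWith.of_dist_le_mul fun a b => by
      rw [Real.dist_eq, dist_eq_norm]; exact hΦ.lip a b y
  have := norm_fderiv_le_of_lipschitz ℝ hl (x₀ := x)
  exact ((fderiv ℝ (fun x' => Φ x' y) x).le_opNorm k).trans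
    (mul_le_mul_of_nonneg_right this (norm_nonneg k))

theorem PotentialBound.integrable_exp_mul_observable (hU : PotentialBound A M N U)
    (hΦ : ObservableBound C K Φ) (hexp : Integrable (fun y : H L => Real.exp (c * ‖y‖ ^ 2)) γ)
    (hN : N < c) (x : H L) : Integrable (fun y => Real.exp (2 * U x y) * Φ x y) γ :=
  hU.integrable_exp_smul hexp hN (hΦ.continuous x).aestronglyMeasurable
    (C := C * (1 + ‖x‖)) (b := 1) (fun y => by
      rw [one_mul]; exact hΦ.le_exp le_rfl y) x

theorem fderiv_exp_mul (hU : PotentialBound A M N U) (hΦ : ObservableBound C K Φ) (x y k : H L) :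
    fderiv ℝ (fun x' => Real.exp (2 * U x' y) * Φ x' y) x k =
      Real.exp (2 * U x y) * (fderiv ℝ (fun x' => Φ x' y) x k) +
        2 * (Real.exp (2 * U x y) * (fderiv ℝ (fun x' => U x' y) x k * Φ x y)) := by
  have h1 := (((hU.differentiable x y).hasFDerivAt.const_mul 2).exp).mul
    (hΦ.differentiable x y).hasFDerivAt
  have h2 := congrArg (fun D : H L →L[ℝ] ℝ => D k) h1.fderiv
  simp only [add_apply, smul_apply, smul_eq_mul] at h2
  refine h2.trans ?_
  ring

/-- Differentiation of weighted Gaussian integrals. -/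
theorem hasFDerivAt_integral_exp_mul (e : HilbertBasis ℕ ℝ (H L)) (hU : PotentialBound A M N U)
    (hΦ : ObservableBound C K Φ) (hexp : Integrable (fun y : H L => Real.exp (c * ‖y‖ ^ 2)) γ)
    (hN : N < c) (x : H L) :
    ∃ D : H L →L[ℝ] ℝ, HasFDerivAt (fun x' => ∫ y, Real.exp (2 * U x' y) * Φ x' y ∂γ) D x ∧
      ∀ k, D k = ∫ y, fderiv ℝ (fun x' => Real.exp (2 * U x' y) * Φ x' y) x k ∂γ := by
  -- All estimates are uniform on the unit ball around `x`. In the dominating function the extra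
  -- `2‖y‖` pays for one factor `exp ‖y‖` from the Lipschitz constant of `U` and one from the growth
  -- of `Φ`.
  set R := ‖x‖ + 1 with hR
  have hR0 : 0 ≤ R := by positivity
  set bound : H L → ℝ := fun y => (2 * M * (C * (1 + R)) + K) *
    Real.exp ((2 * (A + M * R) + 2) * ‖y‖ + N * ‖y‖ ^ 2) with hbound
  have hcont : ∀ x', Continuous fun y => Real.exp (2 * U x' y) * Φ x' y := fun x' =>
    (Real.continuous_exp.comp ((hU.continuous x').const_mul 2)).mul (hΦ.continuous x')
  have hdiff : ∀ y, DifferentiableAt ℝ (fun x' => Real.exp (2 * U x' y) * Φ x' y) x := fun y =>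
    ((hU.differentiable x y).const_mul 2).exp.mul (hΦ.differentiable x y)
  have hM := hU.nonneg_M
  have hC := hΦ.nonneg_C
  have hK := hΦ.nonneg_K
  have hb0 : ∀ y, 0 ≤ bound y := fun y => by positivity
  have hlip : ∀ y, ∀ a ∈ Metric.ball x 1, ∀ b ∈ Metric.ball x 1,
      |Real.exp (2 * U a y) * Φ a y - Real.exp (2 * U b y) * Φ b y| ≤ bound y * ‖a - b‖ := by
    intro y a ha b hb
    have hnorm : ∀ z ∈ Metric.ball x 1, ‖z‖ ≤ R := by
      intro z hz
      rw [mem_ball_iff_norm] at hz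
      have := norm_le_norm_add_norm_sub' z x
      linarith
    have ha' := hU.exp_le (hnorm a ha) y
    have hb' := hU.exp_le (hnorm b hb) y
    set E := Real.exp (2 * (A + M * R) * ‖y‖ + N * ‖y‖ ^ 2) with hE
    have hE0 : 0 ≤ E := (Real.exp_pos _).le
    have e1 := abs_exp_sub_exp_le ha' hb'
    have e2 : |2 * U a y - 2 * U b y| ≤ 2 * (M * ‖y‖ * ‖a - b‖) := by
      rw [← mul_sub, abs_mul, abs_two]
      linarith [hU.lip a b y]
    have e3 := hΦ.le_exp (hnorm a ha) y
    have e4 := hΦ.lip a b y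
    have hy1 : ‖y‖ ≤ Real.exp ‖y‖ := by linarith [Real.add_one_le_exp ‖y‖]
    have hy2 : 1 ≤ Real.exp ‖y‖ := Real.one_le_exp (norm_nonneg y)
    have hbd : bound y = (2 * M * (C * (1 + R)) + K) * (E * (Real.exp ‖y‖ * Real.exp ‖y‖)) := by
      rw [hbound, hE, ← Real.exp_add, ← Real.exp_add]
      simp only
      congr 2
      ring
    have e5 : |Real.exp (2 * U a y) * Φ a y - Real.exp (2 * U b y) * Φ b y| ≤
        |Real.exp (2 * U a y) - Real.exp (2 * U b y)| * |Φ a y| +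
          Real.exp (2 * U b y) * |Φ a y - Φ b y| := by
      rw [← abs_mul, ← Real.abs_exp (2 * U b y), ← abs_mul, Real.abs_exp]
      refine (le_of_eq ?_).trans (abs_add_le _ _)
      congr 1
      ring
    have e6 : |Real.exp (2 * U a y) - Real.exp (2 * U b y)| * |Φ a y| ≤
        (E * (2 * (M * Real.exp ‖y‖ * ‖a - b‖))) * (C * (1 + R) * Real.exp ‖y‖) := by
      refine mul_le_mul (e1.trans (mul_le_mul_of_nonneg_left (e2.trans ?_) hE0)) e3
        (abs_nonneg _) (by positivity)
      gcongr
    have e7 : Real.exp (2 * U b y) * |Φ a y - Φ b y| ≤ E * (K * ‖a - b‖) :=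
      mul_le_mul hb' e4 (abs_nonneg _) hE0
    have e8 : E * (K * ‖a - b‖) ≤ E * (K * ‖a - b‖) * (Real.exp ‖y‖ * Real.exp ‖y‖) :=
      le_mul_of_one_le_right (by positivity) (by nlinarith)
    rw [hbd]
    linarith
  obtain ⟨hi, hd⟩ := hasFDerivAt_integral_of_dominated_loc_of_lip (μ := γ) (𝕜 := ℝ) (x₀ := x)
    (F := fun x' y => Real.exp (2 * U x' y) * Φ x' y) (bound := bound)
    (F' := fun y => fderiv ℝ (fun x' => Real.exp (2 * U x' y) * Φ x' y) x)
    (Metric.ball_mem_nhds x one_pos)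
    (Eventually.of_forall fun x' => (hcont x').aestronglyMeasurable)
    (hU.integrable_exp_mul_observable hΦ hexp hN x)
    (stronglyMeasurable_fderiv (Ψ := fun x' y => Real.exp (2 * U x' y) * Φ x' y) e
      (fun x' => (hcont x').measurable) hdiff).aestronglyMeasurable
    (Eventually.of_forall fun y => LipschitzOnWith.of_dist_le_mul fun a ha b hb => by
      rw [Real.dist_eq, dist_eq_norm, Real.coe_nnabs, abs_of_nonneg (hb0 y)]
      exact hlip y a ha b hb)
    ((integrable_exp_quadratic hexp hN _).const_mul _)
    (Eventually.of_forall fun y => (hdiff y).hasFDerivAt)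
  exact ⟨_, hd, fun k => ContinuousLinearMap.integral_apply hi k⟩

/-- The derivative of the average of an observable under a Gibbs measure. -/
theorem hasFDerivAt_integral_tilted (e : HilbertBasis ℕ ℝ (H L)) [IsProbabilityMeasure γ]
    (hU : PotentialBound A M N U) (hΦ : ObservableBound C K Φ)
    (hexp : Integrable (fun y : H L => Real.exp (c * ‖y‖ ^ 2)) γ) (hN : N < c) (x : H L) :
    DifferentiableAt ℝ (fun x' => ∫ y, Φ x' y ∂(γ.tilted fun y => 2 * U x' y)) x ∧
    ∀ k, Integrable (fun y => fderiv ℝ (fun x' => Φ x' y) x k) (γ.tilted fun y => 2 * U x y) ∧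
      Integrable (fun y => fderiv ℝ (fun x' => U x' y) x k) (γ.tilted fun y => 2 * U x y) ∧
      Integrable (fun y => fderiv ℝ (fun x' => U x' y) x k * Φ x y)
        (γ.tilted fun y => 2 * U x y) ∧
      fderiv ℝ (fun x' => ∫ y, Φ x' y ∂(γ.tilted fun y => 2 * U x' y)) x k =
        (∫ y, fderiv ℝ (fun x' => Φ x' y) x k ∂(γ.tilted fun y => 2 * U x y)) +
        2 * (∫ y, fderiv ℝ (fun x' => U x' y) x k * Φ x y ∂(γ.tilted fun y => 2 * U x y)) -
        2 * (∫ y, fderiv ℝ (fun x' => U x' y) x k ∂(γ.tilted fun y => 2 * U x y)) *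
          ∫ y, Φ x y ∂(γ.tilted fun y => 2 * U x y) := by
  -- The constant observable gives the derivative of the normalization `Z`.
  have hone : ObservableBound (L := L) 1 0 fun _ _ => 1 :=
    ⟨zero_le_one, le_rfl, fun _ => continuous_const, fun x y => by
      rw [abs_one, one_mul]; linarith [norm_nonneg x, norm_nonneg y], fun _ _ _ => by simp,
      fun _ _ => differentiableAt_const _⟩
  set Z : H L → ℝ := fun x' => ∫ y, Real.exp (2 * U x' y) ∂γ with hZ
  have hZpos : ∀ x', 0 < Z x' := fun x' => integral_exp_pos (hU.integrable_exp hexp hN x')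
  have htilt : ∀ (x' : H L) (q : H L → ℝ), ∫ y, q y ∂(γ.tilted fun y => 2 * U x' y) =
      (Z x')⁻¹ * ∫ y, Real.exp (2 * U x' y) * q y ∂γ := by
    intro x' q
    rw [integral_tilted, ← integral_const_mul]
    refine integral_congr_ae (Eventually.of_forall fun y => ?_)
    simp only [smul_eq_mul, hZ]
    ring
  obtain ⟨D₁, hD₁, hD₁k⟩ := hasFDerivAt_integral_exp_mul e hU hΦ hexp hN x
  obtain ⟨D₂, hD₂, hD₂k⟩ := hasFDerivAt_integral_exp_mul e hU hone hexp hN x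
  simp only [mul_one] at hD₂ hD₂k
  -- Quotient rule for numerator over `Z`; the derivative of `Z⁻¹` produces the product of averages
  -- that is subtracted.
  have hder := ((hasDerivAt_inv (hZpos x).ne').comp_hasFDerivAt x hD₂).mul hD₁
  simp only [htilt]
  refine ⟨hder.differentiableAt, fun k => ?_⟩
  have hUm : Measurable fun y => fderiv ℝ (fun x' => U x' y) x k :=
    measurable_fderiv_apply (fun x' => (hU.continuous x').measurable) (hU.differentiable x) k
  have hΦm : Measurable fun y => fderiv ℝ (fun x' => Φ x' y) x k :=
    measurable_fderiv_apply (fun x' => (hΦ.continuous x').measurable) (hΦ.differentiable x) k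
  have hy1 : ∀ y : H L, ‖y‖ ≤ Real.exp ‖y‖ := fun y => by linarith [Real.add_one_le_exp ‖y‖]
  have hMk : ∀ y : H L, ‖fderiv ℝ (fun x' => U x' y) x k‖ ≤ M * ‖k‖ * Real.exp ‖y‖ := fun y => by
    have h1 := mul_le_mul_of_nonneg_left (hy1 y) (mul_nonneg hU.nonneg_M (norm_nonneg k))
    have h2 := hU.norm_fderiv_le x y k
    linarith
  have i1 := hU.integrable_exp_smul hexp hN hΦm.aestronglyMeasurable (C := K * ‖k‖) (b := 0)
    (fun y => by simpa using hΦ.norm_fderiv_le x y k) x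
  have i2 := hU.integrable_exp_smul hexp hN hUm.aestronglyMeasurable (C := M * ‖k‖) (b := 1)
    (fun y => by rw [one_mul]; exact hMk y) x
  have i3 := hU.integrable_exp_smul hexp hN
    (hUm.mul (hΦ.continuous x).measurable).aestronglyMeasurable
    (C := M * ‖k‖ * (C * (1 + ‖x‖))) (b := 2)
    (fun y => by
      rw [Pi.mul_apply, norm_mul, two_mul, Real.exp_add]
      refine (mul_le_mul (hMk y) (hΦ.le_exp le_rfl y) (abs_nonneg _)
        (mul_nonneg (mul_nonneg hU.nonneg_M (norm_nonneg k)) (Real.exp_pos _).le)).trans_eq ?_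
      ring) x
  have hZi := hU.integrable_exp hexp hN x
  refine ⟨(integrable_tilted_iff hZi _).2 i1, (integrable_tilted_iff hZi _).2 i2,
    (integrable_tilted_iff hZi _).2 i3, ?_⟩
  have e0 := congrArg (fun D : H L →L[ℝ] ℝ => D k) hder.fderiv
  simp only [add_apply, smul_apply, smul_eq_mul] at e0
  refine e0.trans ?_
  have e1 : D₁ k = (∫ y, Real.exp (2 * U x y) * fderiv ℝ (fun x' => Φ x' y) x k ∂γ) +
      2 * ∫ y, Real.exp (2 * U x y) * (fderiv ℝ (fun x' => U x' y) x k * Φ x y) ∂γ := by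
    rw [hD₁k, ← integral_const_mul, ← integral_add (f := fun y => Real.exp (2 * U x y) *
      fderiv ℝ (fun x' => Φ x' y) x k) (g := fun y => 2 * (Real.exp (2 * U x y) *
        (fderiv ℝ (fun x' => U x' y) x k * Φ x y))) i1 (i3.const_mul 2)]
    exact integral_congr_ae (Eventually.of_forall fun y => fderiv_exp_mul hU hΦ x y k)
  have e2 : D₂ k = 2 * ∫ y, Real.exp (2 * U x y) * fderiv ℝ (fun x' => U x' y) x k ∂γ := by
    rw [hD₂k, ← integral_const_mul]
    refine integral_congr_ae (Eventually.of_forall fun y => ?_)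
    have := fderiv_exp_mul hU hone x y k
    simpa using this
  rw [e1, e2]
  have := (hZpos x).ne'
  change (Z x)⁻¹ * _ + _ * (-(Z x ^ 2)⁻¹ * _) = _
  field_simp
  ring

end Weighted

end FastSlow

/-! ### The differentiability theorem -/

open FastSlow
theorem lemma5p2 (L : ℝ) (hL : 0 < L)
    (B : EllipticOp L) (e : HilbertBasis ℕ ℝ (H L)) (α : ℕ → ℝ)
    (hB : Diagonalizes B e α)
    (f g : ℝ → ℝ → ℝ → ℝ)
    (hf : SlowReaction L f) (hg : FastReaction L (⨅ k, α k) g) :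
    -- the objects in the formula are well defined
    (∀ x, IsProbabilityMeasure (invMeasure e α g x)) ∧
    (∀ x, Integrable (fun y => nemytskii f x y) (invMeasure e α g x)) ∧
    (∀ x y k : H L, HasLineDerivAt ℝ (fun x' => nemytskii f x' y)
      (nemytskiiDx f x y k) x k) ∧
    (∀ x y : H L, DifferentiableAt ℝ (fun x' => potential g x' y) x) ∧
    -- differentiability of the averaged coefficient and the formula for its derivative
    ∀ h : H L, MemLp h ⊤ (vol L) →
      Differentiable ℝ (fun x => inner ℝ (averaged e α f g x) h) ∧
      ∀ x k : H L,
        Integrable (fun y => inner ℝ (nemytskiiDx f x y k) h)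
          (invMeasure e α g x) ∧
        Integrable (fun y => fderiv ℝ (fun x' => potential g x' y) x k)
          (invMeasure e α g x) ∧
        Integrable (fun y => fderiv ℝ (fun x' => potential g x' y) x k *
            inner ℝ (nemytskii f x y) h) (invMeasure e α g x) ∧
        fderiv ℝ (fun x' => inner ℝ (averaged e α f g x') h) x k =
          (∫ y, inner ℝ (nemytskiiDx f x y k) h ∂(invMeasure e α g x)) +
          2 * (∫ y, fderiv ℝ (fun x' => potential g x' y) x k *
            inner ℝ (nemytskii f x y) h ∂(invMeasure e α g x)) -
          2 * (∫ y, fderiv ℝ (fun x' => potential g x' y) x k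
              ∂(invMeasure e α g x)) *
            (∫ y, inner ℝ (nemytskii f x y) h ∂(invMeasure e α g x)) := by
  have hlam := hB.lambda_le
  have hsum := hB.summable_inv hL
  obtain ⟨Mf, hF⟩ := hf.lipschitz hL
  obtain ⟨M, N, hN, hG⟩ := hg.lipschitz hL
  -- `c < λ` is for the Gaussian moment, `N < c` for absorbing the linear terms of the exponent.
  obtain ⟨c, hNc, hc⟩ := exists_between hN
  have hc0 : 0 ≤ c := hG.nonneg_snd.trans hNc.le
  have := isProbabilityMeasure_gaussian e hB.pos hlam hsum
  have hexp := integrable_exp_norm_sq_gaussian e hlam hc0 hc hsum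
  have hU : PotentialBound ‖nemytskii g (0 : H L) 0‖ M N (potential (L := L) g) :=
    ⟨norm_nonneg _, hG.nonneg_fst,
      fun x => hG.continuous_potential.comp (by fun_prop : Continuous fun y : H L => (x, y)),
      hG.abs_potential_le, hG.abs_potential_sub_le, hg.differentiableAt_potential hG⟩
  have hd : ∀ x y : H L, ∀ᵐ ξ ∂(vol L), DifferentiableAt ℝ (fun s => f ξ s (y ξ)) (x ξ) := by
    intro x y
    filter_upwards [hf.contDiff] with ξ h
    have h1 : DifferentiableAt ℝ (fun σ : ℝ × ℝ => f ξ σ.1 σ.2) (x ξ, y ξ) :=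
      (h.differentiable (by norm_num)) _
    exact h1.comp (x ξ) (f := fun s : ℝ => (s, y ξ)) (by fun_prop)
  have hFc : ∀ x : H L, Continuous fun y : H L => nemytskii f x y := fun x =>
    hF.continuous_nemytskii.comp (by fun_prop : Continuous fun y : H L => (x, y))
  have hprob : ∀ x, IsProbabilityMeasure (invMeasure e α g x) := fun x =>
    isProbabilityMeasure_tilted (hU.integrable_exp hexp hNc x)
  have hint : ∀ x, Integrable (fun y => nemytskii f x y) (invMeasure e α g x) := by
    intro x
    refine (integrable_tilted_iff (hU.integrable_exp hexp hNc x) _).2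
      (hU.integrable_exp_smul hexp hNc (hFc x).aestronglyMeasurable
        (C := ‖nemytskii f (0 : H L) 0‖ + Mf * ‖x‖ + Mf) (b := 1) (fun y => ?_) x)
    have h1 := hF.norm_nemytskii_le x y
    have h2 := Real.add_one_le_exp ‖y‖
    have h3 := hF.nonneg_fst
    have h4 : 0 ≤ ‖nemytskii f (0 : H L) 0‖ + Mf * ‖x‖ := by positivity
    rw [one_mul]
    nlinarith [norm_nonneg y]
  refine ⟨hprob, hint, fun x y k => hF.hasLineDerivAt_nemytskii (hd x y) k,
    hU.differentiable, fun h _ => ?_⟩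
  have hΦ : ObservableBound ((‖nemytskii f (0 : H L) 0‖ + Mf) * ‖h‖) (Mf * ‖h‖)
      fun x y : H L => inner ℝ (nemytskii f x y) h := by
    have hM := hF.nonneg_fst
    refine ⟨by positivity, by positivity, fun x => (hFc x).inner continuous_const,
      fun x y => ?_, fun x x' y => ?_, fun x y => hF.differentiableAt_inner_nemytskii (hd x y) h⟩
    · refine (abs_real_inner_le_norm _ _).trans ?_
      have h1 := hF.norm_nemytskii_le x y
      have h2 : ‖nemytskii f x y‖ ≤
          (‖nemytskii f (0 : H L) 0‖ + Mf) * (1 + ‖x‖ + ‖y‖) := by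
        nlinarith [mul_nonneg (norm_nonneg (nemytskii f (0 : H L) 0)) (norm_nonneg x),
          mul_nonneg (norm_nonneg (nemytskii f (0 : H L) 0)) (norm_nonneg y)]
      have := mul_le_mul_of_nonneg_right h2 (norm_nonneg h)
      linarith
    · rw [← inner_sub_left]
      refine (abs_real_inner_le_norm _ _).trans ?_
      have h1 := hF.norm_nemytskii_sub_le x x' y y
      rw [sub_self, norm_zero, mul_zero, add_zero] at h1
      have := mul_le_mul_of_nonneg_right h1 (norm_nonneg h)
      linarith
  -- Pairing with `h` is continuous and linear, so it passes under the `H`-valued integral; only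
  -- scalar observables remain.
  have havg : (fun x => inner ℝ (averaged e α f g x) h) = fun x =>
      ∫ y, inner ℝ (nemytskii f x y) h ∂((gaussian e α).tilted fun y => 2 * potential g x y) := by
    ext x
    rw [averaged, real_inner_comm, ← integral_inner (hint x) h]
    refine integral_congr_ae (Filter.Eventually.of_forall fun y => ?_)
    exact real_inner_comm _ _
  have key := hasFDerivAt_integral_tilted e hU hΦ hexp hNc
  simp only [havg]
  refine ⟨fun x => (key x).1, fun x k => ?_⟩
  have hk := (key x).2 k
  simp only [hF.fderiv_inner_nemytskii (hd x _) h k] at hk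
  exact hk
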